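/- Let $r\ge 3$, let $k\ge 2$ be an even integer and $A>0$. Fix a uniform grid with cells $I_j=[x_j-\Delta x/2,\,x_j+\Delta x/2]$, $x_j=x_0'+j\Delta x$, and write $\bar u_j$ for the cell averages. \textbf{The scheme.} For $s=0,\dots,r-1$ let $p_s$ be the polynomial of degree at most $r-1$ with cell averages $\bar u_i$ on the cells of the substencil $S_s=\{I_{j-r+1+s},\dots,I_{j+s}\}$, let $u^s_{j+1/2}=p_s(x_{j+1/2})$, let $$\beta_s=\sum_{l=1}^{r-1}\Delta x^{2l-1}\int_{I_j}\bigl(p_s^{(l)}(x)\bigr)^2dx ,\qquad d_s=\binom{r}{s}\binom{r-1}{s}\Big/\binom{2r-1}{r}$$ (the smoothness indicators and the ideal weights, for which $\sum_s d_su^s_{j+1/2}$ is the central upstream reconstruction of order $2r-1$), and let $\omega_s^{\mathrm{JS}}=\alpha_s/\sum_l\alpha_l$ with $\alpha_s=d_s/(\epsilon+\beta_s)^2$, $\epsilon>0$, be the WENO-JS weights. Let $$g^{\mathrm{IM}}(\omega;d)=d+\frac{A(\omega-d)^{k+1}}{A(\omega-d)^{k}+\omega(1-\omega)},\qquad g^{\mathrm{MOP\text{-}IM}}(\omega)=g^{\mathrm{IM}}(\omega;d_{k^*}),$$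 where $k^*=k^*(\omega)$ is the smallest index minimizing $|\omega-d_i|$ over $0\le i\le r-1$. The $(2r-1)$th-order MOP-WENO-IM$(k,A)$ scheme uses the weights $\omega_s=g^{\mathrm{MOP\text{-}IM}}(\omega^{\mathrm{JS}}_s)\big/\sum_l g^{\mathrm{MOP\text{-}IM}}(\omega^{\mathrm{JS}}_l)$, the left-biased value $u^-_{j+1/2}=\sum_s\omega_su^s_{j+1/2}$, the right-biased value $u^+_{j+1/2}$ obtained by mirror symmetry with respect to $x_{j+1/2}$, the Lax--Friedrichs flux $\hat f_{j+1/2}=\frac12\bigl[f(u^-_{j+1/2})+f(u^+_{j+1/2})-\alpha(u^+_{j+1/2}-u^-_{j+1/2})\bigr]$ and the semi-discrete operator $\mathcal L_j=-\frac1{\Delta x}(\hat f_{j+1/2}-\hat f_{j-1/2})$ for $u_t+f(u)_x=0$. \textbf{Claim.} Let $u:\mathbb R\to\mathbb R$ be smooth ($C^\infty$) at a critical point $x^*$ of order $n_{\mathrm{cp}}=1$, i.e. $u'(x^*)=0$ and $u''(x^*)\ne0$; let $f:\mathbb R\to\mathbb R$ be $C^\infty$ and $\alpha\in\mathbb R$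 (for instance $\alpha=\max|f'(u)|$). Then the $(2r-1)$th-order MOP-WENO-IM$(k,A)$ scheme has the optimal order of accuracy $2r-1$ at and near $x^*$: there are constants $C$ and $\delta>0$, independent of $\epsilon$, of the cell and of $\Delta x$, such that whenever $0<\Delta x<\delta$, $|x_j-x^*|<\delta$ and $\epsilon>0$, the scheme applied to the exact cell averages of $u$ satisfies $$\bigl|u^{-}_{j+1/2}-u(x_{j+1/2})\bigr|\le C\Delta x^{2r-1},\qquad \bigl|u^{+}_{j+1/2}-u(x_{j+1/2})\bigr|\le C\Delta x^{2r-1},$$ $$\Bigl|\mathcal L_j+\frac{f(u(x_{j+1/2}))-f(u(x_{j-1/2}))}{\Delta x}\Bigr|\le C\Delta x^{2r-1}.$$ -/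

import Mathlib

open Filter Topology Polynomial
open scoped ContDiff

noncomputable section

namespace MOPWENO

/-!
Everything below is written in the variable `ξ = (x - x_j) / Δx` relative to the current cell
`I_j`, so that the cell `I_{j+m}` becomes `[m - 1/2, m + 1/2]`.  A grid function of cell averages is
`v : ℤ → ℝ`; the reconstruction procedures read it relative to the current cell, i.e. `v m` is the
average over `I_{j+m}`.  The `r` substencils are numbered `s = 0, …, r - 1`.
-/

/-- The reconstruction polynomial `p_s` on the substencil `S_s = {I_{j-r+1+s}, …, I_{j+s}}`: the
polynomial of degree at most `r - 1` whose average over each cell of `S_s` is the given one.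
It is the derivative of the polynomial that interpolates the primitive
(the partial sums of the cell averages) at the `r + 1` cell boundaries of `S_s`. -/
def subPoly (r s : ℕ) (v : ℤ → ℝ) : ℝ[X] :=
  derivative (Lagrange.interpolate (Finset.range (r + 1))
    (fun i : ℕ => (s : ℝ) - r + 1 / 2 + i)
    (fun i : ℕ => ∑ m ∈ Finset.range i, v ((s : ℤ) - r + 1 + m)))

/-- The `r`th-order approximation `u^s_{j+1/2} = p_s(x_{j+1/2})`. -/
def subValue (r s : ℕ) (v : ℤ → ℝ) : ℝ := (subPoly r s v).eval (1 / 2)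

/-- The smoothness indicator of Jiang and Shu,
`β_s = ∑_{l=1}^{r-1} Δx^{2l-1} ∫_{I_j} (d^l p_s / dx^l)^2 dx`
(the powers of `Δx` are absorbed by the variable `ξ`). -/
def smoothness (r s : ℕ) (v : ℤ → ℝ) : ℝ :=
  ∑ l ∈ Finset.Icc 1 (r - 1),
    ∫ ξ in (-1 / 2 : ℝ)..(1 / 2), ((derivative^[l] (subPoly r s v)).eval ξ) ^ 2

/-- The ideal weights `d_s`, for which `∑_s d_s u^s_{j+1/2}` is the central upstream
`(2r-1)`th-order reconstruction on the global stencil `{I_{j-r+1}, …, I_{j+r-1}}`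
(for `r = 3`: `1/10, 6/10, 3/10`). -/
def idealWeight (r s : ℕ) : ℝ :=
  ((r.choose s * (r - 1).choose s : ℕ) : ℝ) / ((2 * r - 1).choose r : ℕ)

/-- Unnormalized WENO-JS weights `α_s = d_s / (ε + β_s)^2`. -/
def alphaJS (r : ℕ) (ε : ℝ) (v : ℤ → ℝ) (s : ℕ) : ℝ :=
  idealWeight r s / (ε + smoothness r s v) ^ 2

/-- The nonlinear weights `ω_s` of the `(2r-1)`th-order WENO-JS scheme. -/
def omegaJS (r : ℕ) (ε : ℝ) (v : ℤ → ℝ) (s : ℕ) : ℝ :=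
  alphaJS r ε v s / ∑ l ∈ Finset.range r, alphaJS r ε v l

/-- The WENO-IM(`k`, `A`) mapping function, with its substencil parameter `d`. -/
def mapIM (k : ℕ) (A d w : ℝ) : ℝ :=
  d + (w - d) ^ (k + 1) * A / ((w - d) ^ k * A + w * (1 - w))

/-- `k* = min (IndexOf (min {|w - d_0|, …, |w - d_{r-1}|}))`, the smallest index of an element of
`d_0, …, d_{r-1}` closest to `w`. -/
def minDistIndex (r : ℕ) (d : ℕ → ℝ) (w : ℝ) : ℕ :=
  sInf {i | i < r ∧ ∀ j < r, |w - d i| ≤ |w - d j|}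

/-- `minDist (x_0, …, x_{r-1}; d_0, …, d_{r-1}; w) = x_{k*}`. -/
def minDist (r : ℕ) (x d : ℕ → ℝ) (w : ℝ) : ℝ := x (minDistIndex r d w)

/-- The order-preserving mapping obtained from WENO-IM(`k`, `A`): the parameter `d_s` of the mapping
function is replaced by the ideal weight closest to the argument.  The result is the same
function for every substencil. -/
def mapMOPIM (r k : ℕ) (A w : ℝ) : ℝ :=
  mapIM k A (minDist r (idealWeight r) (idealWeight r) w) w

/-- The nonlinear weights of the `(2r-1)`th-order MOP-WENO-IM(`k`, `A`) scheme. -/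
def omegaMOPIM (r k : ℕ) (A ε : ℝ) (v : ℤ → ℝ) (s : ℕ) : ℝ :=
  mapMOPIM r k A (omegaJS r ε v s) / ∑ l ∈ Finset.range r, mapMOPIM r k A (omegaJS r ε v l)

/-- The left-biased reconstruction at the right boundary of the cell of index `0` of `v`. -/
def reconstruct (r k : ℕ) (A ε : ℝ) (v : ℤ → ℝ) : ℝ :=
  ∑ s ∈ Finset.range r, omegaMOPIM r k A ε v s * subValue r s v

/-- `u^-_{j+1/2}`. -/
def uMinus (r k : ℕ) (A ε : ℝ) (v : ℤ → ℝ) (j : ℤ) : ℝ :=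
  reconstruct r k A ε (fun m => v (j + m))

/-- `u^+_{j+1/2}`, the mirror image of `u^-_{j+1/2}` with respect to `x_{j+1/2}`. -/
def uPlus (r k : ℕ) (A ε : ℝ) (v : ℤ → ℝ) (j : ℤ) : ℝ :=
  reconstruct r k A ε (fun m => v (j + 1 - m))

/-- The Lax-Friedrichs flux `(f(a) + f(b) - α (b - a)) / 2`. -/
def laxFriedrichs (f : ℝ → ℝ) (α a b : ℝ) : ℝ := (f a + f b - α * (b - a)) / 2

/-- The numerical flux at `x_{j+1/2}` of the `(2r-1)`th-order MOP-WENO-IM(`k`, `A`) scheme. -/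
def numFlux (r k : ℕ) (A ε : ℝ) (f : ℝ → ℝ) (α : ℝ) (v : ℤ → ℝ) (j : ℤ) : ℝ :=
  laxFriedrichs f α (uMinus r k A ε v j) (uPlus r k A ε v j)

/-- The spatial operator of the semi-discrete finite volume MOP-WENO-IM(`k`, `A`) scheme,
`ℒ_j = -(f̂_{j+1/2} - f̂_{j-1/2}) / Δx`. -/
def semiDiscrete (r k : ℕ) (A ε : ℝ) (f : ℝ → ℝ) (α Δx : ℝ) (v : ℤ → ℝ) (j : ℤ) : ℝ :=
  -(1 / Δx) * (numFlux r k A ε f α v j - numFlux r k A ε f α v (j - 1))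

/-- The exact cell averages of `u` on the uniform grid with cell size `Δx` whose cell of index `0`
is centered at `x`. -/
def cellAvg (u : ℝ → ℝ) (x Δx : ℝ) (m : ℤ) : ℝ :=
  (1 / Δx) * ∫ y in (x + m * Δx - Δx / 2)..(x + m * Δx + Δx / 2), u y

/-- `x₀` is a critical point of `u` of order `n`: the derivatives of order `1, …, n` vanish at `x₀`
and the one of order `n + 1` does not. -/
def IsCriticalPointOfOrder (u : ℝ → ℝ) (n : ℕ) (x₀ : ℝ) : Prop :=
  (∀ i, 1 ≤ i → i ≤ n → iteratedDeriv i u x₀ = 0) ∧ iteratedDeriv (n + 1) u x₀ ≠ 0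

end MOPWENO

end

namespace MOPWENO

/-! ### Averages over the cells and the interpolation polynomials -/

/-! Work in the variable `ξ = (x - x_j) / h`, and let `T` be the scaled Taylor polynomial of `u` at
the cell centre, of degree at most `r - 1`. Substencils reproduce `T` exactly and depend linearly on
the data, so each `p_s` and its derivatives equal those of `T` up to `O(h ^ r)`. Near `x₀` the
second derivative of `u` stays away from `0`, so the smoothness indicator `B` of `T` is at least `c
^ 2 * h ^ 4`, and each `β_s` is `B` up to a relative error `O(h ^ (r - 2))`. Hence the JS weights
are within `O(h ^ (r - 2))` of the ideal ones, uniformly in `ε`. The mapping is flat of order `k +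
1` at each ideal weight, which improves this to `O(h ^ ((r - 2) * (k + 1)))`, at most `O(h ^ r)` for
`r ≥ 3` and `k ≥ 2`. Both families of weights sum to `1`, so their effect is a product of two `O(h ^
r)` factors (`exists_abs_reconstruct_sub_le`).

The linear scheme is exact up to degree `2 * r - 2` (`sum_idealWeight_mul_error`), so the total
error is `G x * h ^ (2 * r - 1) + O(h ^ (2 * r))` with `G` Lipschitz
(`exists_reconstruct_expansion`). The Lipschitz bound makes errors at consecutive boundaries differ
by `O(h ^ (2 * r))` only, which absorbs the division by `Δx` in the flux difference. The
right-biased value follows by reflecting `u`. -/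

/-- The average of `g` over the unit cell centered at `m`. -/
noncomputable def unitAvg (g : ℝ → ℝ) (m : ℤ) : ℝ := ∫ ξ in ((m : ℝ) - 1 / 2)..(m + 1 / 2), g ξ

theorem unitAvg_derivative (W : ℝ[X]) (m : ℤ) :
    unitAvg (fun ξ => (derivative W).eval ξ) m =
      W.eval ((m : ℝ) + 1 / 2) - W.eval ((m : ℝ) - 1 / 2) := by
  unfold unitAvg
  rw [intervalIntegral.integral_eq_sub_of_hasDerivAt (fun x _ => W.hasDerivAt x)]
  exact (derivative W).continuous.intervalIntegrable _ _

theorem cellAvg_eq_unitAvg (u : ℝ → ℝ) (x : ℝ) {h : ℝ} (hh : 0 < h) (m : ℤ) :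
    cellAvg u x h m = unitAvg (fun ξ => u (x + h * ξ)) m := by
  unfold cellAvg unitAvg
  rw [intervalIntegral.integral_comp_add_mul u hh.ne', smul_eq_mul, one_div]
  congr 2 <;> ring

theorem exists_derivative_eq (P : ℝ[X]) :
    ∃ W : ℝ[X], derivative W = P ∧ W.natDegree ≤ P.natDegree + 1 := by
  refine ⟨∑ i ∈ Finset.range (P.natDegree + 1), C (P.coeff i / (i + 1)) * X ^ (i + 1), ?_, ?_⟩
  · conv_rhs => rw [P.as_sum_range_C_mul_X_pow]
    rw [derivative_sum]
    refine Finset.sum_congr rfl fun i _ => ?_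
    rw [derivative_C_mul_X_pow]
    have : (i : ℝ) + 1 ≠ 0 := by positivity
    congr 2
    push_cast
    field_simp
  · refine natDegree_sum_le_of_forall_le _ _ fun i hi => ?_
    refine (natDegree_C_mul_X_pow_le _ _).trans ?_
    have := Finset.mem_range.1 hi
    omega

/-- The cell boundaries of the substencil `S_s`. -/
noncomputable def node (r s : ℕ) (i : ℕ) : ℝ := (s : ℝ) - r + 1 / 2 + i

theorem node_injOn (r s : ℕ) (t : Set ℕ) : Set.InjOn (node r s) t := by
  intro a _ b _ hab
  simpa [node] using hab

theorem subPoly_eq_sum (r s : ℕ) (v : ℤ → ℝ) :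
    subPoly r s v = ∑ i ∈ Finset.range (r + 1),
      C (∑ m ∈ Finset.range i, v ((s : ℤ) - r + 1 + m)) *
        derivative (Lagrange.basis (Finset.range (r + 1)) (node r s) i) := by
  unfold subPoly
  rw [Lagrange.interpolate_apply, derivative_sum]
  refine Finset.sum_congr rfl fun i _ => ?_
  rw [derivative_C_mul]
  rfl

theorem subPoly_add (r s : ℕ) (v w : ℤ → ℝ) :
    subPoly r s (v + w) = subPoly r s v + subPoly r s w := by
  simp only [subPoly_eq_sum, Pi.add_apply, Finset.sum_add_distrib, C_add, add_mul]

theorem subPoly_smul (r s : ℕ) (a : ℝ) (v : ℤ → ℝ) :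
    subPoly r s (a • v) = C a * subPoly r s v := by
  simp only [subPoly_eq_sum, Pi.smul_apply, smul_eq_mul, ← Finset.mul_sum, C_mul, mul_assoc]

/-- The interpolant of a primitive of the data on the substencil. -/
theorem exists_interpolant (r s : ℕ) (W : ℝ[X]) :
    ∃ I : ℝ[X], I.natDegree ≤ r ∧ (∀ i ≤ r, I.eval (node r s i) = W.eval (node r s i)) ∧
      subPoly r s (unitAvg fun ξ => (derivative W).eval ξ) = derivative I := by
  set vals : ℕ → ℝ := fun i : ℕ => ∑ m ∈ Finset.range i,
    (unitAvg fun ξ => (derivative W).eval ξ) ((s : ℤ) - r + 1 + m)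
  set I₀ := Lagrange.interpolate (Finset.range (r + 1)) (node r s) vals with hI₀
  have hvals : ∀ i, vals i = W.eval (node r s i) - W.eval (node r s 0) := by
    intro i
    rw [← Finset.sum_range_sub (fun i => W.eval (node r s i))]
    refine Finset.sum_congr rfl fun m _ => ?_
    rw [unitAvg_derivative]
    congr 2 <;> (simp only [node]; push_cast; ring)
  -- The partial sums telescope to `W` minus its value at the first node; that constant is restored
  -- here and disappears on differentiation.
  refine ⟨I₀ + C (W.eval (node r s 0)), ?_, ?_, ?_⟩
  · refine natDegree_add_le_of_degree_le ?_ (by simp)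
    refine natDegree_le_of_degree_le ?_
    refine (Lagrange.degree_interpolate_le _ (node_injOn r s _)).trans ?_
    simp
  · intro i hi
    rw [eval_add, hI₀, Lagrange.eval_interpolate_at_node _ (node_injOn r s _)
      (Finset.mem_range.2 (by omega)), hvals, eval_C]
    ring
  · rw [derivative_add, derivative_C, add_zero]
    rfl

/-- A substencil reproduces the polynomials of degree less than `r`. -/
theorem subPoly_unitAvg {r : ℕ} (s : ℕ) {P : ℝ[X]} (hP : P.natDegree < r) :
    subPoly r s (unitAvg fun ξ => P.eval ξ) = P := by
  obtain ⟨W, rfl, hW⟩ := exists_derivative_eq P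
  obtain ⟨I, hI, hIW, h⟩ := exists_interpolant r s W
  rw [h]
  congr 1
  refine eq_of_degrees_lt_of_eval_index_eq (Finset.range (r + 1)) (node_injOn r s _) ?_ ?_
    fun i hi => hIW i (by have := Finset.mem_range.1 hi; omega)
  · rw [Finset.card_range]
    exact lt_of_le_of_lt degree_le_natDegree (by exact_mod_cast Nat.lt_succ_of_le hI)
  · rw [Finset.card_range]
    exact lt_of_le_of_lt degree_le_natDegree (by exact_mod_cast (by omega))

/-! ### The ideal weights -/

/-- The quotient is the polynomial form of `(p x - p a) / (x - a)`. It turns a derivative at `a`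
into a value at `a`, on which finite differences can act. -/
theorem exists_eq_mul_X_sub_C {p : ℝ[X]} {n : ℕ} (hp : p.natDegree ≤ n + 1) (a : ℝ) :
    ∃ q : ℝ[X], q.natDegree ≤ n ∧ (∀ x, p.eval x = p.eval a + (x - a) * q.eval x) ∧
      (derivative p).eval a = q.eval a := by
  refine ⟨p /ₘ (X - C a), ?_, ?_, ?_⟩
  · rw [natDegree_divByMonic _ (monic_X_sub_C a), natDegree_X_sub_C]
    omega
  · intro x
    conv_lhs => rw [← modByMonic_add_div p (X - C a), modByMonic_X_sub_C_eq_C_eval]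
    simp
  · conv_lhs => rw [← modByMonic_add_div p (X - C a), modByMonic_X_sub_C_eq_C_eval]
    simp

/-- Let `J` be the difference quotient at `1 / 2` of the interpolant of `W`. It has degree less than
`r`, so its `r`th difference vanishes. At every node except `1 / 2` it agrees with `V`, so the `r`th
difference of `V - J` collapses to the single term at `1 / 2`, where `J` takes the value `subValue`.
-/
theorem choose_mul_subValue_error {r s : ℕ} (hs : s < r) {W V : ℝ[X]}
    (hV : ∀ x, W.eval x = W.eval (1 / 2) + (x - 1 / 2) * V.eval x) :
    (r.choose s : ℝ) * (V.eval (1 / 2) - subValue r s (unitAvg fun ξ => (derivative W).eval ξ)) =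
      (-1) ^ s * (fwdDiff (1 : ℝ))^[r] V.eval (node r s 0) := by
  obtain ⟨I, hI, hIW, h⟩ := exists_interpolant r s W
  obtain ⟨J, hJ, hIJ, hI'⟩ := exists_eq_mul_X_sub_C (n := r - 1) (a := 1 / 2)
    (hI.trans (by omega))
  have hmid : node r s (r - s) = 1 / 2 := by
    simp only [node]; rw [Nat.cast_sub hs.le]; ring
  have h0 : (fwdDiff (1 : ℝ))^[r] J.eval (node r s 0) = 0 := by
    rw [Polynomial.fwdDiff_iter_eq_zero_of_degree_lt (by omega)]; rfl
  have hnode : ∀ i : ℕ, node r s 0 + i • (1 : ℝ) = node r s i := by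
    intro i; simp [node]
  rw [← sub_zero ((fwdDiff (1 : ℝ))^[r] V.eval (node r s 0)), ← h0, fwdDiff_iter_eq_sum_shift,
    fwdDiff_iter_eq_sum_shift, ← Finset.sum_sub_distrib]
  rw [Finset.sum_eq_single (r - s)]
  · rw [hnode, hmid, subValue, h, hI', ← smul_sub, Nat.sub_sub_self hs.le, Nat.choose_symm hs.le,
      zsmul_eq_mul]
    push_cast
    rw [← mul_assoc, ← mul_assoc, ← pow_add, ← two_mul, pow_mul]
    simp
  · intro i hi hne
    rw [hnode, ← smul_sub]
    have h1 := hIJ (node r s i)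
    have hi' := Finset.mem_range.1 hi
    have hmid' := hIW (r - s) (by omega)
    rw [hmid] at hmid'
    rw [hIW i (by omega), hV, hmid'] at h1
    have hn : node r s i - 1 / 2 ≠ 0 := by
      rw [← hmid, sub_ne_zero]
      exact fun h => hne (node_injOn r s Set.univ trivial trivial h)
    have : V.eval (node r s i) = J.eval (node r s i) := mul_left_cancel₀ hn (by linarith)
    rw [this, sub_self, smul_zero]
  · intro hn
    exact absurd (Finset.mem_range.2 (by omega)) hn

/-- The ideal weights combine the substencils to a reconstruction that is exact on polynomials of
degree at most `2 r - 2`. -/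
theorem sum_idealWeight_mul_error {r : ℕ} (hr : 1 ≤ r) {P : ℝ[X]} (hP : P.natDegree ≤ 2 * r - 2) :
    ∑ s ∈ Finset.range r, idealWeight r s *
      (P.eval (1 / 2) - subValue r s (unitAvg fun ξ => P.eval ξ)) = 0 := by
  obtain ⟨W, rfl, hW⟩ := exists_derivative_eq P
  obtain ⟨V, hV, hWV, hV'⟩ := exists_eq_mul_X_sub_C (n := 2 * r - 2) (a := 1 / 2)
    (hW.trans (by omega))
  -- Moving from `s` to `s + 1` shifts the stencil by one cell, so the ideal weights assemble the
  -- substencil errors into an `(r - 1)`th difference of `r`th differences of `V`. This total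
  -- difference of order `2 * r - 1` annihilates `V`, whose degree is at most `2 * r - 2`.
  have key : (fwdDiff (1 : ℝ))^[r - 1] ((fwdDiff (1 : ℝ))^[r] V.eval) (node r 0 0) = 0 := by
    rw [← Function.iterate_add_apply, Polynomial.fwdDiff_iter_eq_zero_of_degree_lt (by omega)]
    rfl
  rw [fwdDiff_iter_eq_sum_shift, Nat.sub_add_cancel hr] at key
  have hterm : ∀ s ∈ Finset.range r, idealWeight r s * ((derivative W).eval (1 / 2) -
      subValue r s (unitAvg fun ξ => (derivative W).eval ξ)) =
      ((-1) ^ (r - 1) / ((2 * r - 1).choose r : ℝ)) *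
        (((-1 : ℤ) ^ (r - 1 - s) * ((r - 1).choose s : ℤ)) •
          (fwdDiff (1 : ℝ))^[r] V.eval (node r 0 0 + s • (1 : ℝ))) := by
    intro s hs
    have hs' := Finset.mem_range.1 hs
    have hnode : node r 0 0 + s • (1 : ℝ) = node r s 0 := by simp [node]; ring
    have h1 := choose_mul_subValue_error hs' hWV
    have hsgn : ((-1 : ℝ)) ^ (r - 1) * (-1) ^ (r - 1 - s) = (-1) ^ s := by
      rw [← pow_add, show r - 1 + (r - 1 - s) = s + 2 * (r - 1 - s) by omega, pow_add, pow_mul]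
      simp
    rw [hnode, hV', idealWeight, zsmul_eq_mul]
    push_cast
    calc _ = ((r - 1).choose s / ((2 * r - 1).choose r : ℝ)) * (r.choose s * (V.eval (1 / 2) -
          subValue r s (unitAvg fun ξ => (derivative W).eval ξ))) := by ring
      _ = _ := by rw [h1, ← hsgn]; ring
  rw [Finset.sum_congr rfl hterm, ← Finset.mul_sum, key, mul_zero]

theorem idealWeight_pos {r s : ℕ} (hs : s < r) : 0 < idealWeight r s := by
  unfold idealWeight
  have h1 : 0 < r.choose s := Nat.choose_pos hs.le
  have h2 : 0 < (r - 1).choose s := Nat.choose_pos (by omega)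
  have h3 : 0 < (2 * r - 1).choose r := Nat.choose_pos (by omega)
  positivity

theorem sum_idealWeight {r : ℕ} (hr : 1 ≤ r) : ∑ s ∈ Finset.range r, idealWeight r s = 1 := by
  have h3 : 0 < (2 * r - 1).choose r := Nat.choose_pos (by omega)
  unfold idealWeight
  rw [← Finset.sum_div, div_eq_one_iff_eq (by positivity), ← Nat.cast_sum]
  congr 1
  -- Vandermonde's identity for `r + (r - 1)`.
  rw [← Nat.choose_symm (by omega), show 2 * r - 1 = r + (r - 1) by omega, Nat.add_choose_eq,
    Finset.Nat.sum_antidiagonal_eq_sum_range_succ (fun i j => r.choose i * (r - 1).choose j),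
    show r + (r - 1) - r = r - 1 by omega, Nat.succ_eq_add_one, Nat.sub_add_cancel hr]
  refine Finset.sum_congr rfl fun s hs => ?_
  have := Finset.mem_range.1 hs
  rw [Nat.choose_symm (by omega)]

theorem idealWeight_lt_one {r s : ℕ} (hr : 2 ≤ r) (hs : s < r) : idealWeight r s < 1 := by
  obtain ⟨t, ht, hne⟩ : ∃ t < r, t ≠ s := by
    by_cases h : s = 0
    · exact ⟨1, by omega, by omega⟩
    · exact ⟨0, by omega, by omega⟩
  rw [← sum_idealWeight (r := r) (by omega)]
  exact Finset.single_lt_sum hne (Finset.mem_range.2 hs) (Finset.mem_range.2 ht)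
    (idealWeight_pos ht) fun i hi _ => (idealWeight_pos (Finset.mem_range.1 hi)).le

/-! ### The nonlinear weights -/

/-- Normalization costs only a constant factor: with `S` the sum of the `a s`, the error is `((a s -
d s) - d s * (S - 1)) / S`, where `|S - 1| ≤ r * τ` and `S ≥ 1 / 2`. Used for the JS weights and
again for the mapped ones. -/
theorem abs_div_sum_sub_le {r : ℕ} {a d : ℕ → ℝ} {τ : ℝ} (hd0 : ∀ s < r, 0 ≤ d s)
    (hd1 : ∑ s ∈ Finset.range r, d s = 1) (ha : ∀ s < r, |a s - d s| ≤ τ) (hτ : r * τ ≤ 1 / 2) :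
    1 / 2 ≤ ∑ l ∈ Finset.range r, a l ∧
      ∀ s < r, |a s / (∑ l ∈ Finset.range r, a l) - d s| ≤ 2 * (1 + r) * τ := by
  set S := ∑ l ∈ Finset.range r, a l with hS
  have hS1 : |S - 1| ≤ r * τ := by
    rw [← hd1, hS, ← Finset.sum_sub_distrib]
    calc _ ≤ ∑ s ∈ Finset.range r, |a s - d s| := Finset.abs_sum_le_sum_abs _ _
      _ ≤ ∑ s ∈ Finset.range r, τ := Finset.sum_le_sum fun s hs => ha s (Finset.mem_range.1 hs)
      _ = r * τ := by simp
  have hS2 : 1 / 2 ≤ S := by have := (abs_le.1 hS1).1; linarith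
  refine ⟨hS2, fun s hs => ?_⟩
  have hS0 : 0 < S := by linarith
  have hds : d s ≤ 1 := by
    rw [← hd1]
    exact Finset.single_le_sum (fun i hi => hd0 i (Finset.mem_range.1 hi)) (Finset.mem_range.2 hs)
  have h1 : a s / S - d s = (a s - d s - d s * (S - 1)) / S := by field_simp; ring
  have h2 : |a s - d s - d s * (S - 1)| ≤ (1 + r) * τ := by
    calc _ ≤ |a s - d s| + |d s * (S - 1)| := abs_sub _ _
      _ ≤ τ + 1 * (r * τ) := by
        rw [abs_mul, abs_of_nonneg (hd0 s hs)]
        exact add_le_add (ha s hs)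
          (mul_le_mul hds hS1 (abs_nonneg _) zero_le_one)
      _ = _ := by ring
  have h3 := (abs_nonneg _).trans h2
  rw [h1, abs_div, abs_of_pos hS0, div_le_iff₀ hS0]
  nlinarith

theorem abs_div_sq_sub_one_le {a b η : ℝ} (hb : 0 < b) (hη : η ≤ 1 / 2) (h : |a - b| ≤ η * b) :
    |b ^ 2 / a ^ 2 - 1| ≤ 10 * η := by
  obtain ⟨h1, h2⟩ := abs_le.1 h
  have hη0 : 0 ≤ η := by
    have := (abs_nonneg _).trans h
    exact nonneg_of_mul_nonneg_left this hb
  have ha : b / 2 ≤ a := by nlinarith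
  have ha0 : 0 < a := by linarith
  have h3 : b ^ 2 / a ^ 2 - 1 = (b - a) * (b + a) / a ^ 2 := by field_simp; ring
  rw [h3, abs_div, abs_mul, abs_of_pos (by positivity : 0 < b + a),
    abs_of_pos (by positivity : 0 < a ^ 2), div_le_iff₀ (by positivity), abs_sub_comm]
  calc |a - b| * (b + a) ≤ (η * b) * (b + a) := by gcongr
    _ ≤ η * (10 * a ^ 2) := by
        rw [mul_assoc]
        exact mul_le_mul_of_nonneg_left (by nlinarith) hη0
    _ = _ := by ring

/-- If the smoothness indicators agree up to a relative error `η`, then the WENO-JS weights differ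
from the ideal weights by `O(η)`, whatever the value of `ε`. -/
theorem abs_omegaJS_sub_le {r : ℕ} (hr : 1 ≤ r) {ε B η : ℝ} {v : ℤ → ℝ} (hε : 0 < ε) (hB : 0 < B)
    (hβ : ∀ s < r, |smoothness r s v - B| ≤ η * B) (hη : r * (10 * η) ≤ 1 / 2)
    {s : ℕ} (hs : s < r) :
    |omegaJS r ε v s - idealWeight r s| ≤ 2 * (1 + r) * (10 * η) := by
  have hη0 : 0 ≤ η := nonneg_of_mul_nonneg_left ((abs_nonneg _).trans (hβ s hs)) hB
  have hr1 : (1 : ℝ) ≤ r := by exact_mod_cast hr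
  have hη1 : η ≤ 1 / 2 := by nlinarith
  have hb : 0 < ε + B := by linarith
  -- The common factor `(ε + B) ^ 2` cancels in the normalized weights and brings each `α_s` close
  -- to `d_s`. Adding `ε > 0` to both indicators only lowers their relative difference, hence the
  -- uniformity in `ε`.
  have h := (abs_div_sum_sub_le (r := r) (a := fun s => (ε + B) ^ 2 * alphaJS r ε v s)
    (d := idealWeight r) (τ := 10 * η) (fun s hs => (idealWeight_pos hs).le) (sum_idealWeight hr)
    ?_ hη).2 s hs
  · rw [← Finset.mul_sum, mul_div_mul_left _ _ (by positivity)] at h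
    exact h
  · intro s hs
    have h1 := abs_div_sq_sub_one_le (a := ε + smoothness r s v) hb hη1 (by
      rw [add_sub_add_left_eq_sub]
      exact (hβ s hs).trans (by nlinarith))
    have h2 : (ε + B) ^ 2 * alphaJS r ε v s - idealWeight r s =
        idealWeight r s * ((ε + B) ^ 2 / (ε + smoothness r s v) ^ 2 - 1) := by
      unfold alphaJS; ring
    have h3 : idealWeight r s ≤ 1 := by
      rw [← sum_idealWeight hr]
      exact Finset.single_le_sum (fun i hi => (idealWeight_pos (Finset.mem_range.1 hi)).le)
        (Finset.mem_range.2 hs)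
    rw [h2, abs_mul, abs_of_pos (idealWeight_pos hs)]
    calc _ ≤ 1 * (10 * η) := mul_le_mul h3 h1 (abs_nonneg _) zero_le_one
      _ = _ := one_mul _

theorem minDistIndex_spec {r : ℕ} (hr : 1 ≤ r) (d : ℕ → ℝ) (w : ℝ) :
    minDistIndex r d w < r ∧ ∀ j < r, |w - d (minDistIndex r d w)| ≤ |w - d j| := by
  have hne : {i | i < r ∧ ∀ j < r, |w - d i| ≤ |w - d j|}.Nonempty := by
    obtain ⟨i, hi, h⟩ := Finset.exists_min_image (Finset.range r) (fun i => |w - d i|)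
      ⟨0, Finset.mem_range.2 hr⟩
    exact ⟨i, Finset.mem_range.1 hi, fun j hj => h j (Finset.mem_range.2 hj)⟩
  exact Nat.sInf_mem hne

/-- Near `d_s` the closest of the parameters is `d_s` itself. -/
theorem exists_minDist_eq (r : ℕ) (d : ℕ → ℝ) :
    ∃ γ > 0, ∀ s < r, ∀ w, |w - d s| < γ → minDist r d d w = d s := by
  -- Only gaps between distinct values count: the conclusion concerns the value `d s` and not its
  -- index, so the `d s` may have repetitions.
  obtain ⟨γ, hγ, h⟩ : ∃ γ > 0, ∀ p ∈ Finset.range r ×ˢ Finset.range r,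
      d p.1 ≠ d p.2 → γ ≤ |d p.1 - d p.2| := by
    set t := (Finset.range r ×ˢ Finset.range r).filter fun p => d p.1 ≠ d p.2
    rcases t.eq_empty_or_nonempty with ht | ht
    · exact ⟨1, one_pos, fun p hp hne => absurd (Finset.mem_filter.2 ⟨hp, hne⟩) (by
        change p ∉ t; simp [ht])⟩
    · obtain ⟨p, hp, hmin⟩ := Finset.exists_min_image t (fun p => |d p.1 - d p.2|) ht
      exact ⟨|d p.1 - d p.2|, abs_pos.2 (sub_ne_zero.2 (Finset.mem_filter.1 hp).2),
        fun q hq hne => hmin q (Finset.mem_filter.2 ⟨hq, hne⟩)⟩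
  refine ⟨γ / 2, by positivity, fun s hs w hw => ?_⟩
  obtain ⟨h1, h2⟩ := minDistIndex_spec (r := r) (by omega) d w
  unfold minDist
  by_contra hne
  have h3 := h (minDistIndex r d w, s) (by simp [h1, hs]) hne
  have h4 := h2 s hs
  have h5 := abs_sub_le (d (minDistIndex r d w)) w (d s)
  rw [abs_sub_comm (d _) w] at h5
  simp only at h3
  linarith

/-- Evenness of `k` makes the first term of the denominator nonnegative, so `w * (1 - w)` alone
bounds the denominator below. -/
theorem abs_mapIM_sub_le {k : ℕ} (hk : Even k) {A d w c : ℝ} (hA : 0 < A) (hc : 0 < c)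
    (hw : c ≤ w * (1 - w)) : |mapIM k A d w - d| ≤ A / c * |w - d| ^ (k + 1) := by
  have h1 : c ≤ (w - d) ^ k * A + w * (1 - w) := by
    have := mul_nonneg (hk.pow_nonneg (w - d)) hA.le
    linarith
  unfold mapIM
  rw [add_sub_cancel_left, abs_div, abs_mul, abs_pow, abs_of_pos hA,
    abs_of_pos (hc.trans_le h1), div_mul_eq_mul_div, mul_comm A]
  exact div_le_div_of_nonneg_left (by positivity) hc h1

/-- Near the ideal weight `d_s` the order-preserving mapping is flat of order `k + 1`. -/
theorem exists_abs_mapMOPIM_sub_le {r k : ℕ} (hr : 2 ≤ r) (hk : Even k) {A : ℝ} (hA : 0 < A) :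
    ∃ K ≥ 0, ∃ γ > 0, ∀ s < r, ∀ w, |w - idealWeight r s| < γ →
      |mapMOPIM r k A w - idealWeight r s| ≤ K * |w - idealWeight r s| ^ (k + 1) := by
  obtain ⟨γ₁, hγ₁, h1⟩ := exists_minDist_eq r (idealWeight r)
  obtain ⟨c, hc, hcd⟩ : ∃ c > 0, ∀ s < r, c ≤ idealWeight r s ∧ c ≤ 1 - idealWeight r s := by
    obtain ⟨i, hi, h⟩ := Finset.exists_min_image (Finset.range r)
      (fun s => min (idealWeight r s) (1 - idealWeight r s)) ⟨0, Finset.mem_range.2 (by omega)⟩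
    rw [Finset.mem_range] at hi
    exact ⟨_, lt_min (idealWeight_pos hi) (sub_pos.2 (idealWeight_lt_one hr hi)),
      fun s hs => le_min_iff.1 (h s (Finset.mem_range.2 hs))⟩
  refine ⟨A / (c / 2 * (c / 2)), by positivity, min γ₁ (c / 2), by positivity, fun s hs w hw => ?_⟩
  obtain ⟨hw1, hw2⟩ := lt_min_iff.1 hw
  obtain ⟨hw3, hw4⟩ := abs_lt.1 hw2
  obtain ⟨h2, h3⟩ := hcd s hs
  unfold mapMOPIM
  rw [h1 s hs w hw1]
  exact abs_mapIM_sub_le hk hA (by positivity)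
    (mul_le_mul (by linarith) (by linarith) (by positivity) (by linarith))

/-- If the smoothness indicators agree up to a relative error `η`, then the weights of the
MOP-WENO-IM scheme differ from the ideal weights by `O(η ^ (k + 1))`. -/
theorem exists_abs_omegaMOPIM_sub_le {r k : ℕ} (hr : 2 ≤ r) (hk : Even k) {A : ℝ} (hA : 0 < A) :
    ∃ K ≥ 0, ∃ η₀ > 0, ∀ η < η₀, ∀ v : ℤ → ℝ, ∀ B > 0, ∀ ε > 0,
      (∀ s < r, |smoothness r s v - B| ≤ η * B) →
        ∑ s ∈ Finset.range r, omegaMOPIM r k A ε v s = 1 ∧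
          ∀ s < r, |omegaMOPIM r k A ε v s - idealWeight r s| ≤ K * η ^ (k + 1) := by
  obtain ⟨K, hK, γ, hγ, h⟩ := exists_abs_mapMOPIM_sub_le (k := k) hr hk hA
  have hr0 : (0 : ℝ) < r := by exact_mod_cast (by omega : 0 < r)
  set c : ℝ := 2 * (1 + r) * 10 with hc
  have hc0 : 0 < c := by positivity
  set D : ℝ := K * c ^ (k + 1) with hD
  have hD0 : 0 ≤ D := by positivity
  -- The four bounds on `η` serve, in order: the smallness required for the JS weights, their entry
  -- into the zone where the mapping is flat, `η ^ (k + 1) ≤ η`, and the smallness required to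
  -- normalize the mapped weights.
  refine ⟨2 * (1 + r) * D, by positivity,
    min (min (1 / (20 * r)) (γ / c)) (min 1 (1 / (2 * r * (D + 1)))), by positivity,
    fun η hη v B hB ε hε hβ => ?_⟩
  obtain ⟨hη', hη''⟩ := lt_min_iff.1 hη
  obtain ⟨hη1, hη2⟩ := lt_min_iff.1 hη'
  obtain ⟨hη3, hη4⟩ := lt_min_iff.1 hη''
  rw [lt_div_iff₀ (by positivity)] at hη1 hη2 hη4
  have hη0 : 0 ≤ η := nonneg_of_mul_nonneg_left ((abs_nonneg _).trans (hβ 0 (by omega))) hB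
  have hmap : ∀ s < r, |mapMOPIM r k A (omegaJS r ε v s) - idealWeight r s| ≤ D * η ^ (k + 1) := by
    intro s hs
    have h1 : |omegaJS r ε v s - idealWeight r s| ≤ c * η :=
      (abs_omegaJS_sub_le (by omega) hε hB hβ (by linarith) hs).trans (by rw [hc]; linarith)
    refine (h s hs _ (h1.trans_lt (by linarith))).trans ?_
    rw [hD, mul_assoc, ← mul_pow]
    gcongr
  have hpow : η ^ (k + 1) ≤ η := pow_le_of_le_one hη0 hη3.le (by omega)
  obtain ⟨hS, hω⟩ := abs_div_sum_sub_le (fun s hs => (idealWeight_pos hs).le)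
    (sum_idealWeight (by omega)) hmap (by
      have : D * η ^ (k + 1) ≤ (D + 1) * η := by gcongr; linarith
      nlinarith)
  refine ⟨?_, fun s hs => (hω s hs).trans_eq (by ring)⟩
  unfold omegaMOPIM
  rw [← Finset.sum_div, div_self (by linarith)]

/-! ### Stability of the reconstruction -/

theorem unitAvg_eval_add (P Q : ℝ[X]) :
    (unitAvg fun ξ => (P + Q).eval ξ) =
      (unitAvg fun ξ => P.eval ξ) + unitAvg fun ξ => Q.eval ξ := by
  funext m
  simp only [unitAvg, eval_add, Pi.add_apply]
  exact intervalIntegral.integral_add (P.continuous.intervalIntegrable _ _)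
    (Q.continuous.intervalIntegrable _ _)

theorem unitAvg_eval_C_mul (a : ℝ) (P : ℝ[X]) :
    (unitAvg fun ξ => (C a * P).eval ξ) = a • unitAvg fun ξ => P.eval ξ := by
  funext m
  simp [unitAvg]

theorem subValue_add (r s : ℕ) (v w : ℤ → ℝ) :
    subValue r s (v + w) = subValue r s v + subValue r s w := by
  rw [subValue, subPoly_add, eval_add]; rfl

theorem subValue_smul (r s : ℕ) (a : ℝ) (v : ℤ → ℝ) :
    subValue r s (a • v) = a * subValue r s v := by
  rw [subValue, subPoly_smul, eval_mul, eval_C]; rfl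

/-- The polynomial is a combination of finitely many fixed polynomials, bounded on the compact cell,
with partial sums of at most `r` data values as coefficients. -/
theorem exists_abs_eval_subPoly_le (r : ℕ) :
    ∃ K ≥ 0, ∀ s < r, ∀ l < r, ∀ ξ ∈ Set.Icc (-1 / 2 : ℝ) (1 / 2), ∀ (v : ℤ → ℝ) (M : ℝ),
      (∀ m : ℤ, |m| ≤ r → |v m| ≤ M) →
        |(derivative^[l] (subPoly r s v)).eval ξ| ≤ K * M := by
  have hb : ∀ p : ℝ[X], ∃ c, ∀ ξ ∈ Set.Icc (-1 / 2 : ℝ) (1 / 2), |p.eval ξ| ≤ c := fun p =>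
    isCompact_Icc.exists_bound_of_continuousOn p.continuous.continuousOn
  set b : ℕ → ℕ → ℕ → ℝ[X] := fun s l i => derivative^[l]
    (derivative (Lagrange.basis (Finset.range (r + 1)) (node r s) i)) with hbdef
  choose c hc using fun s l i => hb (b s l i)
  have hc0 : ∀ s l i, 0 ≤ c s l i := fun s l i =>
    (abs_nonneg _).trans (hc s l i 0 ⟨by norm_num, by norm_num⟩)
  refine ⟨∑ s ∈ Finset.range r, ∑ l ∈ Finset.range r, ∑ i ∈ Finset.range (r + 1), r * c s l i,
    Finset.sum_nonneg fun s _ => Finset.sum_nonneg fun l _ => Finset.sum_nonneg fun i _ =>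
      mul_nonneg (Nat.cast_nonneg _) (hc0 _ _ _), fun s hs l hl ξ hξ v M hv => ?_⟩
  have hM : 0 ≤ M := (abs_nonneg _).trans (hv 0 (by simp))
  have h1 : ∑ i ∈ Finset.range (r + 1), r * c s l i ≤ ∑ s ∈ Finset.range r,
      ∑ l ∈ Finset.range r, ∑ i ∈ Finset.range (r + 1), r * c s l i :=
    (Finset.single_le_sum (f := fun l => ∑ i ∈ Finset.range (r + 1), r * c s l i)
      (fun l _ => Finset.sum_nonneg fun i _ => mul_nonneg (Nat.cast_nonneg _) (hc0 _ _ _))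
      (Finset.mem_range.2 hl)).trans
    (Finset.single_le_sum
      (f := fun s => ∑ l ∈ Finset.range r, ∑ i ∈ Finset.range (r + 1), r * c s l i)
      (fun s _ => Finset.sum_nonneg fun l _ => Finset.sum_nonneg fun i _ =>
        mul_nonneg (Nat.cast_nonneg _) (hc0 _ _ _)) (Finset.mem_range.2 hs))
  refine le_trans ?_ (mul_le_mul_of_nonneg_right h1 hM)
  rw [subPoly_eq_sum, iterate_derivative_sum, eval_finsetSum, Finset.sum_mul]
  refine (Finset.abs_sum_le_sum_abs _ _).trans (Finset.sum_le_sum fun i hi => ?_)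
  have hi' := Finset.mem_range.1 hi
  rw [iterate_derivative_C_mul, eval_mul, eval_C, abs_mul]
  have h2 : |∑ m ∈ Finset.range i, v ((s : ℤ) - r + 1 + m)| ≤ r * M := by
    calc _ ≤ ∑ m ∈ Finset.range i, |v ((s : ℤ) - r + 1 + m)| := Finset.abs_sum_le_sum_abs _ _
      _ ≤ ∑ m ∈ Finset.range i, M := Finset.sum_le_sum fun m hm => hv _ (by
          have := Finset.mem_range.1 hm
          rw [abs_le]; constructor <;> omega)
      _ = i * M := by simp
      _ ≤ r * M := by gcongr; omega
  calc _ ≤ (r * M) * c s l i := mul_le_mul h2 (hc s l i ξ hξ) (abs_nonneg _) (by positivity)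
    _ = _ := by ring

theorem abs_integral_sq_sub_le {p q : ℝ[X]} {M H : ℝ}
    (h : ∀ ξ ∈ Set.Icc (-1 / 2 : ℝ) (1 / 2), |p.eval ξ ^ 2 - q.eval ξ ^ 2| ≤
      M * (H + q.eval ξ ^ 2)) :
    |(∫ ξ in (-1 / 2 : ℝ)..(1 / 2), p.eval ξ ^ 2) - ∫ ξ in (-1 / 2 : ℝ)..(1 / 2), q.eval ξ ^ 2| ≤
      M * (H + ∫ ξ in (-1 / 2 : ℝ)..(1 / 2), q.eval ξ ^ 2) := by
  have hp : Continuous fun ξ => p.eval ξ ^ 2 := p.continuous.pow 2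
  have hq : Continuous fun ξ => q.eval ξ ^ 2 := q.continuous.pow 2
  rw [← intervalIntegral.integral_sub (hp.intervalIntegrable _ _) (hq.intervalIntegrable _ _)]
  refine (intervalIntegral.abs_integral_le_integral_abs (by norm_num)).trans ?_
  refine (intervalIntegral.integral_mono_on (by norm_num)
    ((hp.sub hq).abs.intervalIntegrable _ _)
    ((continuous_const.mul (continuous_const.add hq)).intervalIntegrable _ _) h).trans_eq ?_
  change ∫ ξ in (-1 / 2 : ℝ)..(1 / 2), M * (H + q.eval ξ ^ 2) = _
  rw [intervalIntegral.integral_const_mul, intervalIntegral.integral_add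
    (continuous_const.intervalIntegrable _ _) (hq.intervalIntegrable _ _)]
  norm_num

/-- The cross term is handled by `2 * h ^ 2 * |q| ≤ h ^ 4 + q ^ 2`. This keeps the whole factor `t`,
later `h ^ (r - 2)`, as a relative error, since `h ^ 4` is dominated by the indicator of `T`. -/
theorem abs_sq_sub_sq_le {p q D t h : ℝ} (hD : 0 ≤ D) (ht0 : 0 ≤ t) (ht1 : t ≤ 1)
    (hpq : |p - q| ≤ D * (t * h ^ 2)) :
    |p ^ 2 - q ^ 2| ≤ (D + D ^ 2) * t * (h ^ 4 + q ^ 2) := by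
  have h1 : p ^ 2 - q ^ 2 = (p - q) * (2 * q + (p - q)) := by ring
  have h2 : |2 * q + (p - q)| ≤ 2 * |q| + D * (t * h ^ 2) :=
    (abs_add_le _ _).trans (add_le_add (by rw [abs_mul, abs_two]) hpq)
  rw [h1, abs_mul]
  calc _ ≤ D * (t * h ^ 2) * (2 * |q| + D * (t * h ^ 2)) :=
        mul_le_mul hpq h2 (abs_nonneg _) (by positivity)
    _ = D * t * (2 * h ^ 2 * |q|) + D ^ 2 * t * (t * h ^ 4) := by ring
    _ ≤ D * t * (h ^ 4 + q ^ 2) + D ^ 2 * t * (h ^ 4 + q ^ 2) := by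
        have h3 : 2 * h ^ 2 * |q| ≤ h ^ 4 + q ^ 2 := by
          rw [← sq_abs q]; nlinarith [sq_nonneg (h ^ 2 - |q|)]
        have h4 : t * h ^ 4 ≤ h ^ 4 + q ^ 2 := by
          have : 0 ≤ h ^ 4 := by positivity
          nlinarith [sq_nonneg q]
        gcongr
    _ = _ := by ring

/-- Exactness on `T` and linearity leave only the reconstruction of the Taylor remainder, to which
the stability bound applies. -/
theorem subPoly_eq_add {r s : ℕ} {T : ℝ[X]} (hT : T.natDegree < r) (v : ℤ → ℝ) :
    subPoly r s v = T + subPoly r s (v - unitAvg fun ξ => T.eval ξ) := by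
  conv_rhs => enter [1]; rw [← subPoly_unitAvg s hT]
  rw [← subPoly_add, add_sub_cancel]

/-- The smoothness indicators of the substencils agree up to a relative error `O(h ^ (r - 2))`
where the second derivative does not vanish. -/
theorem exists_abs_smoothness_sub_le {r : ℕ} (hr : 3 ≤ r) {c K : ℝ} (hc : 0 < c) (hK : 0 ≤ K) :
    ∃ N ≥ 0, ∀ h : ℝ, 0 < h → h ≤ 1 → ∀ (v : ℤ → ℝ) (T : ℝ[X]), T.natDegree < r →
      (∀ m : ℤ, |m| ≤ r → |v m - unitAvg (fun ξ => T.eval ξ) m| ≤ K * h ^ r) →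
      (∀ ξ ∈ Set.Icc (-1 / 2 : ℝ) (1 / 2), c * h ^ 2 ≤ |(derivative^[2] T).eval ξ|) →
        ∃ B > 0, ∀ s < r, |smoothness r s v - B| ≤ N * h ^ (r - 2) * B := by
  obtain ⟨K₁, hK₁, hbound⟩ := exists_abs_eval_subPoly_le r
  set D := K₁ * K with hD
  have hD0 : 0 ≤ D := mul_nonneg hK₁ hK
  refine ⟨(D + D ^ 2) * (r / c ^ 2 + 1), by positivity, fun h hh hh1 v T hT hv hT2 => ?_⟩
  set J : ℕ → ℝ := fun l => ∫ ξ in (-1 / 2 : ℝ)..(1 / 2), ((derivative^[l] T).eval ξ) ^ 2 with hJ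
  have hJ0 : ∀ l, 0 ≤ J l := fun l =>
    intervalIntegral.integral_nonneg (by norm_num) fun ξ _ => sq_nonneg _
  set B := ∑ l ∈ Finset.Icc 1 (r - 1), J l with hBdef
  -- The term `l = 2`, present because `r ≥ 3`, bounds `B` below even where the first derivative
  -- vanishes.
  have hJ2 : c ^ 2 * h ^ 4 ≤ J 2 := by
    have h1 : ∫ ξ in (-1 / 2 : ℝ)..(1 / 2), c ^ 2 * h ^ 4 = c ^ 2 * h ^ 4 := by norm_num
    rw [← h1]
    refine intervalIntegral.integral_mono_on (by norm_num)
      (continuous_const.intervalIntegrable _ _)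
      (((derivative^[2] T).continuous.pow 2).intervalIntegrable _ _) fun ξ hξ => ?_
    rw [← sq_abs ((derivative^[2] T).eval ξ)]
    calc c ^ 2 * h ^ 4 = (c * h ^ 2) ^ 2 := by ring
      _ ≤ _ := by have := hT2 ξ hξ; gcongr
  have hB : c ^ 2 * h ^ 4 ≤ B := hJ2.trans
    (Finset.single_le_sum (fun l _ => hJ0 l) (Finset.mem_Icc.2 ⟨by norm_num, by omega⟩))
  refine ⟨B, lt_of_lt_of_le (by positivity) hB, fun s hs => ?_⟩
  have ht1 : h ^ (r - 2) ≤ 1 := pow_le_one₀ hh.le hh1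
  have ht : h ^ r = h ^ (r - 2) * h ^ 2 := by rw [← pow_add]; congr 1; omega
  have hterm : ∀ l ∈ Finset.Icc 1 (r - 1),
      |(∫ ξ in (-1 / 2 : ℝ)..(1 / 2), ((derivative^[l] (subPoly r s v)).eval ξ) ^ 2) - J l| ≤
        (D + D ^ 2) * h ^ (r - 2) * (h ^ 4 + J l) := by
    intro l hl
    obtain ⟨_, hl2⟩ := Finset.mem_Icc.1 hl
    refine abs_integral_sq_sub_le fun ξ hξ => abs_sq_sub_sq_le hD0 (by positivity) ht1 ?_
    rw [subPoly_eq_add hT v, iterate_map_add, eval_add, add_sub_cancel_left, ← ht, hD,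
      mul_assoc]
    exact hbound s hs l (by omega) ξ hξ _ _ hv
  unfold smoothness
  rw [hBdef, ← Finset.sum_sub_distrib]
  calc _ ≤ ∑ l ∈ Finset.Icc 1 (r - 1), (D + D ^ 2) * h ^ (r - 2) * (h ^ 4 + J l) :=
        (Finset.abs_sum_le_sum_abs _ _).trans (Finset.sum_le_sum hterm)
    _ = (D + D ^ 2) * h ^ (r - 2) * ((r - 1 : ℕ) * h ^ 4 + B) := by
        rw [← Finset.mul_sum, Finset.sum_add_distrib]; simp [hBdef]
    _ ≤ (D + D ^ 2) * h ^ (r - 2) * (r / c ^ 2 * B + B) := by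
        have h1 : ((r - 1 : ℕ) : ℝ) ≤ r := by exact_mod_cast Nat.sub_le _ _
        have h2 : ((r - 1 : ℕ) : ℝ) * h ^ 4 ≤ r / c ^ 2 * B := by
          calc _ ≤ (r : ℝ) * h ^ 4 := by gcongr
            _ = r / c ^ 2 * (c ^ 2 * h ^ 4) := by field_simp
            _ ≤ _ := by gcongr
        gcongr
    _ = _ := by rw [← hBdef]; ring

/-- The nonlinear weights change the reconstruction with the ideal weights by `O(h ^ (2 r))`
only. -/
theorem exists_abs_reconstruct_sub_le {r k : ℕ} (hr : 3 ≤ r) (hk : 2 ≤ k) (hke : Even k)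
    {A c K : ℝ} (hA : 0 < A) (hc : 0 < c) (hK : 0 ≤ K) :
    ∃ N ≥ 0, ∃ h₀ > 0, ∀ h : ℝ, 0 < h → h < h₀ → ∀ (v : ℤ → ℝ) (T : ℝ[X]), T.natDegree < r →
      (∀ m : ℤ, |m| ≤ r → |v m - unitAvg (fun ξ => T.eval ξ) m| ≤ K * h ^ r) →
      (∀ ξ ∈ Set.Icc (-1 / 2 : ℝ) (1 / 2), c * h ^ 2 ≤ |(derivative^[2] T).eval ξ|) →
        ∀ ε > 0, |reconstruct r k A ε v - ∑ s ∈ Finset.range r, idealWeight r s * subValue r s v| ≤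
          N * h ^ (2 * r) := by
  obtain ⟨K₁, hK₁, hbound⟩ := exists_abs_eval_subPoly_le r
  obtain ⟨Nβ, hNβ, hβ⟩ := exists_abs_smoothness_sub_le hr hc hK
  obtain ⟨Kω, hKω, η₀, hη₀, hω⟩ := exists_abs_omegaMOPIM_sub_le (k := k) (by omega : 2 ≤ r) hke hA
  refine ⟨r * (Kω * Nβ ^ (k + 1) * (K₁ * K)), by positivity, min 1 (η₀ / (Nβ + 1)),
    by positivity, fun h hh hh0 v T hT hv hT2 ε hε => ?_⟩
  obtain ⟨hh1, hh2⟩ := lt_min_iff.1 hh0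
  rw [lt_div_iff₀ (by positivity)] at hh2
  obtain ⟨B, hB, hβB⟩ := hβ h hh hh1.le v T hT hv hT2
  have hpow : h ^ (r - 2) ≤ h := pow_le_of_le_one hh.le hh1.le (by omega)
  have hη : Nβ * h ^ (r - 2) < η₀ := by nlinarith [mul_le_mul_of_nonneg_left hpow hNβ]
  obtain ⟨hsum, hdiff⟩ := hω _ hη v B hB ε hε hβB
  -- With `k + 1 ≥ 3` and `r ≥ 3`, `(r - 2) * (k + 1) ≥ 3 * (r - 2) ≥ r`.
  have hexp : h ^ ((r - 2) * (k + 1)) ≤ h ^ r := by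
    refine pow_le_pow_of_le_one hh.le hh1.le ?_
    obtain ⟨a, rfl⟩ : ∃ a, r = a + 3 := ⟨r - 3, by omega⟩
    rw [show a + 3 - 2 = a + 1 by omega]
    nlinarith
  -- As both families of weights sum to `1`, the value of `T` can be subtracted from every
  -- substencil value, leaving a second factor `O(h ^ r)`.
  have hrec : reconstruct r k A ε v - ∑ s ∈ Finset.range r, idealWeight r s * subValue r s v =
      ∑ s ∈ Finset.range r, (omegaMOPIM r k A ε v s - idealWeight r s) *
        (subValue r s v - T.eval (1 / 2)) := by
    have h1 : ∑ s ∈ Finset.range r, (omegaMOPIM r k A ε v s - idealWeight r s) *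
        T.eval (1 / 2) = 0 := by
      rw [← Finset.sum_mul, Finset.sum_sub_distrib, hsum, sum_idealWeight (by omega)]; ring
    simp only [mul_sub, Finset.sum_sub_distrib (f := fun s => _ * subValue r s v), h1, sub_zero]
    simp only [reconstruct, sub_mul, Finset.sum_sub_distrib]
  rw [hrec]
  calc _ ≤ ∑ s ∈ Finset.range r, |(omegaMOPIM r k A ε v s - idealWeight r s) *
        (subValue r s v - T.eval (1 / 2))| := Finset.abs_sum_le_sum_abs _ _
    _ ≤ ∑ s ∈ Finset.range r, Kω * Nβ ^ (k + 1) * h ^ r * (K₁ * K * h ^ r) := by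
        refine Finset.sum_le_sum fun s hs => ?_
        have hs' := Finset.mem_range.1 hs
        rw [abs_mul]
        refine mul_le_mul ((hdiff s hs').trans ?_) ?_ (abs_nonneg _) (by positivity)
        · rw [mul_pow, ← pow_mul, mul_assoc]
          gcongr
        · rw [subValue, subPoly_eq_add hT v, eval_add, add_sub_cancel_left, mul_assoc]
          exact hbound s hs' 0 (by omega) (1 / 2) ⟨by norm_num, le_rfl⟩ _ _ hv
    _ = _ := by
        rw [Finset.sum_const, Finset.card_range, nsmul_eq_mul, two_mul, pow_add]; ring

/-- The leading error term of the reconstruction with the ideal weights. -/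
theorem exists_abs_linear_reconstruct_sub_le {r : ℕ} (hr : 1 ≤ r) :
    ∃ κ : ℝ, ∃ K ≥ 0, ∀ P : ℝ[X], P.natDegree ≤ 2 * r - 1 → ∀ (v : ℤ → ℝ) (M : ℝ),
      (∀ m : ℤ, |m| ≤ r → |v m - unitAvg (fun ξ => P.eval ξ) m| ≤ M) →
        |∑ s ∈ Finset.range r, idealWeight r s * subValue r s v - P.eval (1 / 2) -
          κ * P.coeff (2 * r - 1)| ≤ K * M := by
  obtain ⟨K₁, hK₁, hbound⟩ := exists_abs_eval_subPoly_le r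
  set err : ℝ[X] → ℝ := fun P => ∑ s ∈ Finset.range r, idealWeight r s *
    (P.eval (1 / 2) - subValue r s (unitAvg fun ξ => P.eval ξ)) with herr
  refine ⟨-err (X ^ (2 * r - 1)), K₁, hK₁, fun P hP v M hv => ?_⟩
  -- The error functional is linear and vanishes on `Q`, so it sees only the top coefficient.
  set Q := P - C (P.coeff (2 * r - 1)) * X ^ (2 * r - 1) with hQ
  have hQd : Q.natDegree ≤ 2 * r - 2 := by
    rw [natDegree_le_iff_coeff_eq_zero]
    intro n hn
    rw [hQ, coeff_sub, coeff_C_mul_X_pow]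
    split_ifs with h
    · rw [h, sub_self]
    · rw [coeff_eq_zero_of_natDegree_lt (by omega), sub_zero]
  have herrP : err P = P.coeff (2 * r - 1) * err (X ^ (2 * r - 1)) := by
    have h1 : P = Q + C (P.coeff (2 * r - 1)) * X ^ (2 * r - 1) := by rw [hQ]; ring
    have h2 : err Q = 0 := sum_idealWeight_mul_error hr hQd
    have h3 : err P = err Q + P.coeff (2 * r - 1) * err (X ^ (2 * r - 1)) := by
      conv_lhs => rw [h1]
      simp only [herr, unitAvg_eval_add, unitAvg_eval_C_mul, subValue_add, subValue_smul]
      simp only [Finset.mul_sum, ← Finset.sum_add_distrib, eval_add, eval_C_mul]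
      refine Finset.sum_congr rfl fun s _ => ?_
      ring
    rw [h3, h2, zero_add]
  have hsplit : ∀ s, subValue r s v = subValue r s (unitAvg fun ξ => P.eval ξ) +
      subValue r s (v - unitAvg fun ξ => P.eval ξ) := by
    intro s; rw [← subValue_add, add_sub_cancel]
  have hmain : ∑ s ∈ Finset.range r, idealWeight r s * subValue r s v - P.eval (1 / 2) -
      -err (X ^ (2 * r - 1)) * P.coeff (2 * r - 1) =
      ∑ s ∈ Finset.range r, idealWeight r s *
        subValue r s (v - unitAvg fun ξ => P.eval ξ) := by
    have h1 : -err (X ^ (2 * r - 1)) * P.coeff (2 * r - 1) = -err P := by rw [herrP]; ring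
    have h2 : err P = P.eval (1 / 2) - ∑ s ∈ Finset.range r, idealWeight r s *
        subValue r s (unitAvg fun ξ => P.eval ξ) := by
      simp only [herr, mul_sub, Finset.sum_sub_distrib, ← Finset.sum_mul, sum_idealWeight hr,
        one_mul]
    rw [h1, h2]
    simp only [hsplit, mul_add, Finset.sum_add_distrib]
    ring
  rw [hmain]
  calc _ ≤ ∑ s ∈ Finset.range r, |idealWeight r s *
        subValue r s (v - unitAvg fun ξ => P.eval ξ)| := Finset.abs_sum_le_sum_abs _ _
    _ ≤ ∑ s ∈ Finset.range r, idealWeight r s * (K₁ * M) := by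
        refine Finset.sum_le_sum fun s hs => ?_
        have hs' := Finset.mem_range.1 hs
        rw [abs_mul, abs_of_pos (idealWeight_pos hs')]
        exact mul_le_mul_of_nonneg_left
          (hbound s hs' 0 (by omega) (1 / 2) ⟨by norm_num, le_rfl⟩ _ _ hv) (idealWeight_pos hs').le
    _ = _ := by rw [← Finset.sum_mul, sum_idealWeight hr, one_mul]

/-! ### Taylor expansions with uniform remainder -/

/-- By induction: the derivative of the remainder is the remainder of one order less for the shifted
family, and the mean value inequality integrates its bound. The factor `1 / n!` is not needed. An
abstract family `φ` lets the bound apply to derivatives of `u` as well. -/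
theorem abs_taylor_remainder_le {I : Set ℝ} (hI : Convex ℝ I) {K : ℝ} {n : ℕ} {φ : ℕ → ℝ → ℝ}
    (hφ : ∀ i < n, ∀ y ∈ I, HasDerivAt (φ i) (φ (i + 1) y) y) (hK : ∀ y ∈ I, |φ n y| ≤ K)
    {x y : ℝ} (hx : x ∈ I) (hy : y ∈ I) :
    |φ 0 y - ∑ i ∈ Finset.range n, φ i x / i.factorial * (y - x) ^ i| ≤ K * |y - x| ^ n := by
  induction n generalizing φ y with
  | zero => simpa using hK y hy
  | succ n ih =>
    have hK0 : 0 ≤ K := (abs_nonneg _).trans (hK x hx)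
    set F : ℝ → ℝ := fun t =>
      φ 0 t - ∑ i ∈ Finset.range (n + 1), φ i x / i.factorial * (t - x) ^ i with hF
    have hFx : F x = 0 := by
      rw [hF]; simp only [sub_self]; rw [Finset.sum_range_succ']; simp
    have hseg : Set.uIcc x y ⊆ I := by
      rw [← segment_eq_uIcc]; exact hI.segment_subset hx hy
    have hder : ∀ t ∈ Set.uIcc x y, HasDerivWithinAt F (φ 1 t - ∑ i ∈ Finset.range n,
        φ (i + 1) x / i.factorial * (t - x) ^ i) (Set.uIcc x y) t := by
      intro t ht
      refine (HasDerivAt.sub (hφ 0 (by omega) t (hseg ht)) ?_).hasDerivWithinAt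
      simp only [Finset.sum_range_succ' _ n, pow_zero, mul_one]
      refine HasDerivAt.add_const _ (HasDerivAt.fun_sum fun i _ => ?_)
      have h1 := (((hasDerivAt_id t).sub_const x).pow (i + 1)).const_mul
        (φ (i + 1) x / ((i + 1).factorial : ℝ))
      refine h1.congr_deriv ?_
      have h2 : ((i + 1).factorial : ℝ) = (i + 1) * i.factorial := by
        rw [Nat.factorial_succ]; push_cast; ring
      have h3 : (i : ℝ) + 1 ≠ 0 := by positivity
      have h4 : (i.factorial : ℝ) ≠ 0 := by positivity
      rw [h2]
      push_cast
      simp only [id]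
      field_simp
    have hbd : ∀ t ∈ Set.uIcc x y, ‖φ 1 t - ∑ i ∈ Finset.range n,
        φ (i + 1) x / i.factorial * (t - x) ^ i‖ ≤ K * |y - x| ^ n := by
      intro t ht
      refine (ih (φ := fun i => φ (i + 1)) (fun i hi => hφ (i + 1) (by omega)) hK
        (hseg ht)).trans ?_
      have : |t - x| ≤ |y - x| := by
        exact Set.abs_sub_left_of_mem_uIcc ht
      gcongr
    have h := (convex_uIcc x y).norm_image_sub_le_of_norm_hasDerivWithin_le hder hbd
      Set.left_mem_uIcc Set.right_mem_uIcc
    rw [hFx, sub_zero, Real.norm_eq_abs, Real.norm_eq_abs] at h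
    rw [pow_succ, ← mul_assoc]
    exact h

theorem differentiableAt_iteratedDeriv {u : ℝ → ℝ} {n : ℕ} {y : ℝ}
    (hu : ContDiffAt ℝ (n + 1 : ℕ) u y) : DifferentiableAt ℝ (iteratedDeriv n u) y := by
  rw [iteratedDeriv_eq_equiv_comp]
  refine ((ContinuousMultilinearMap.piFieldEquiv ℝ (Fin n) ℝ).symm.differentiableAt).comp y ?_
  refine (hu.iteratedFDeriv_right (m := 1) (i := n) ?_).differentiableAt one_ne_zero
  push_cast
  rw [add_comm]

theorem exists_iteratedDeriv_bound {u : ℝ → ℝ} {x₀ : ℝ} (hu : ContDiffAt ℝ ∞ u x₀) (n : ℕ) :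
    ∃ ρ > 0, ∃ K ≥ 0, ∀ y ∈ Metric.ball x₀ ρ, ∀ i ≤ n,
      HasDerivAt (iteratedDeriv i u) (iteratedDeriv (i + 1) u y) y ∧ |iteratedDeriv i u y| ≤ K := by
  have h1 : ∀ᶠ y in 𝓝 x₀, ContDiffAt ℝ (n + 1 : ℕ) u y :=
    (hu.of_le (by exact_mod_cast le_top)).eventually (by simp)
  have hd : ∀ y, ContDiffAt ℝ (n + 1 : ℕ) u y → ∀ i ≤ n,
      HasDerivAt (iteratedDeriv i u) (iteratedDeriv (i + 1) u y) y := fun y hy i hi => by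
    rw [iteratedDeriv_succ]
    exact (differentiableAt_iteratedDeriv (hy.of_le (by exact_mod_cast (by omega)))).hasDerivAt
  set K := ∑ i ∈ Finset.range (n + 1), (|iteratedDeriv i u x₀| + 1) with hK
  have h2 : ∀ᶠ y in 𝓝 x₀, ∀ i ∈ Finset.range (n + 1), |iteratedDeriv i u y| < K := by
    rw [Filter.eventually_all_finset]
    intro i hi
    have hc : ContinuousAt (fun y => |iteratedDeriv i u y|) x₀ :=
      (hd x₀ h1.self_of_nhds i (by have := Finset.mem_range.1 hi; omega)).continuousAt.abs
    refine hc.eventually_lt continuousAt_const ?_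
    refine lt_of_lt_of_le (lt_add_one _) ?_
    exact Finset.single_le_sum (f := fun i => |iteratedDeriv i u x₀| + 1)
      (fun i _ => by positivity) hi
  obtain ⟨ρ, hρ, h⟩ := Metric.eventually_nhds_iff_ball.1 (h1.and h2)
  exact ⟨ρ, hρ, K, Finset.sum_nonneg fun i _ => by positivity, fun y hy i hi =>
    ⟨hd y (h y hy).1 i hi, ((h y hy).2 i (Finset.mem_range.2 (by omega))).le⟩⟩

/-- The Taylor polynomial of degree less than `n` at `x` of a function with the derivatives `φ`,
in the variable `(y - x) / h`. -/
noncomputable def scaledTaylor (φ : ℕ → ℝ → ℝ) (x h : ℝ) (n : ℕ) : ℝ[X] :=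
  ∑ i ∈ Finset.range n, C (φ i x / i.factorial * h ^ i) * X ^ i

theorem eval_scaledTaylor (φ : ℕ → ℝ → ℝ) (x h : ℝ) (n : ℕ) (ξ : ℝ) :
    (scaledTaylor φ x h n).eval ξ =
      ∑ i ∈ Finset.range n, φ i x / i.factorial * (x + h * ξ - x) ^ i := by
  simp only [scaledTaylor, eval_finsetSum, eval_mul, eval_C, eval_pow, eval_X, add_sub_cancel_left,
    mul_pow, mul_assoc]

theorem natDegree_scaledTaylor_le (φ : ℕ → ℝ → ℝ) (x h : ℝ) (n : ℕ) :
    (scaledTaylor φ x h (n + 1)).natDegree ≤ n :=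
  natDegree_sum_le_of_forall_le _ _ fun i hi =>
    (natDegree_C_mul_X_pow_le _ _).trans (by have := Finset.mem_range.1 hi; omega)

theorem coeff_scaledTaylor (φ : ℕ → ℝ → ℝ) (x h : ℝ) {n i : ℕ} (hi : i < n) :
    (scaledTaylor φ x h n).coeff i = φ i x / i.factorial * h ^ i := by
  simp only [scaledTaylor, finsetSum_coeff, coeff_C_mul_X_pow]
  rw [Finset.sum_ite_eq, if_pos (Finset.mem_range.2 hi)]

theorem derivative_scaledTaylor (φ : ℕ → ℝ → ℝ) (x h : ℝ) (n : ℕ) :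
    derivative (scaledTaylor φ x h (n + 1)) = C h * scaledTaylor (fun i => φ (i + 1)) x h n := by
  unfold scaledTaylor
  rw [derivative_sum, Finset.sum_range_succ', Finset.mul_sum]
  simp only [pow_zero, mul_one, derivative_C, add_zero]
  refine Finset.sum_congr rfl fun i _ => ?_
  rw [derivative_C_mul_X_pow, ← mul_assoc, ← C_mul, Nat.add_sub_cancel, Nat.factorial_succ]
  congr 2
  have h3 : (i : ℝ) + 1 ≠ 0 := by positivity
  have h4 : (i.factorial : ℝ) ≠ 0 := by positivity
  push_cast
  field_simp
  ring

theorem abs_sub_scaledTaylor_le {I : Set ℝ} (hI : Convex ℝ I) {K : ℝ} {n : ℕ} {φ : ℕ → ℝ → ℝ}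
    (hφ : ∀ i < n, ∀ y ∈ I, HasDerivAt (φ i) (φ (i + 1) y) y) (hK : ∀ y ∈ I, |φ n y| ≤ K)
    {x h ξ : ℝ} (hx : x ∈ I) (hξ : x + h * ξ ∈ I) :
    |φ 0 (x + h * ξ) - (scaledTaylor φ x h n).eval ξ| ≤ K * |h * ξ| ^ n := by
  rw [eval_scaledTaylor]
  simpa using abs_taylor_remainder_le hI hφ hK hx hξ

/-- The cells with `|m| ≤ r` lie in `|ξ| ≤ r + 1`, and averaging over a unit cell preserves the
pointwise Taylor bound. -/
theorem abs_cellAvg_sub_le {I : Set ℝ} (hI : Convex ℝ I) {K : ℝ} {n r : ℕ} {φ : ℕ → ℝ → ℝ}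
    (hφ0 : ContinuousOn (φ 0) I)
    (hφ : ∀ i < n, ∀ y ∈ I, HasDerivAt (φ i) (φ (i + 1) y) y) (hK0 : 0 ≤ K)
    (hK : ∀ y ∈ I, |φ n y| ≤ K) {x h : ℝ} (hh : 0 < h) (hx : x ∈ I)
    (hball : ∀ ξ : ℝ, |ξ| ≤ r + 1 → x + h * ξ ∈ I) {m : ℤ} (hm : |m| ≤ r) :
    |cellAvg (φ 0) x h m - unitAvg (fun ξ => (scaledTaylor φ x h n).eval ξ) m| ≤
      K * (r + 1) ^ n * h ^ n := by
  have hm' : |(m : ℝ)| ≤ r := by exact_mod_cast hm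
  obtain ⟨hm1, hm2⟩ := abs_le.1 hm'
  have hle : (m : ℝ) - 1 / 2 ≤ m + 1 / 2 := by linarith
  have hmem : ∀ ξ ∈ Set.uIcc ((m : ℝ) - 1 / 2) (m + 1 / 2), |ξ| ≤ r + 1 := by
    intro ξ hξ
    rw [Set.uIcc_of_le hle] at hξ
    rw [abs_le]
    constructor <;> linarith [hξ.1, hξ.2]
  have hint : IntervalIntegrable (fun ξ => φ 0 (x + h * ξ)) MeasureTheory.volume
      ((m : ℝ) - 1 / 2) (m + 1 / 2) := by
    refine ContinuousOn.intervalIntegrable (hφ0.comp (by fun_prop) fun ξ hξ => ?_)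
    exact hball ξ (hmem ξ hξ)
  rw [cellAvg_eq_unitAvg _ _ hh, unitAvg, unitAvg, ← intervalIntegral.integral_sub hint
    ((scaledTaylor φ x h n).continuous.intervalIntegrable _ _)]
  have h1 := intervalIntegral.norm_integral_le_of_norm_le_const (a := (m : ℝ) - 1 / 2)
    (b := m + 1 / 2) (C := K * (r + 1) ^ n * h ^ n)
    (f := fun ξ => φ 0 (x + h * ξ) - (scaledTaylor φ x h n).eval ξ) (fun ξ hξ => by
      have hξ' := hmem ξ (Set.uIoc_subset_uIcc hξ)
      refine (abs_sub_scaledTaylor_le hI hφ hK hx (hball ξ hξ')).trans ?_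
      rw [abs_mul, abs_of_pos hh, mul_pow, mul_comm (h ^ n), ← mul_assoc]
      gcongr)
  refine h1.trans_eq ?_
  rw [show (m : ℝ) + 1 / 2 - (m - 1 / 2) = 1 by ring, abs_one, mul_one]

/-- The error expansion of the left-biased reconstruction from exact cell averages. -/
theorem exists_reconstruct_expansion {r k : ℕ} (hr : 3 ≤ r) (hk : 2 ≤ k) (hke : Even k) {A : ℝ}
    (hA : 0 < A) {u : ℝ → ℝ} {x₀ : ℝ} (hu : ContDiffAt ℝ ∞ u x₀) (hu2 : iteratedDeriv 2 u x₀ ≠ 0) :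
    ∃ G : ℝ → ℝ, ∃ N ≥ 0, ∃ δ > 0,
      (∀ x ∈ Metric.ball x₀ δ, |G x| ≤ N) ∧
      (∀ x ∈ Metric.ball x₀ δ, ∀ y ∈ Metric.ball x₀ δ, |G x - G y| ≤ N * |x - y|) ∧
      ∀ x ∈ Metric.ball x₀ δ, ∀ h : ℝ, 0 < h → h < δ → ∀ ε > 0,
        |reconstruct r k A ε (cellAvg u x h) - u (x + h / 2) - G x * h ^ (2 * r - 1)| ≤
          N * h ^ (2 * r) := by
  obtain ⟨ρ₁, hρ₁, K, hK, hball₁⟩ := exists_iteratedDeriv_bound hu (2 * r)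
  -- Nearby `|u''| > 2 * c`; one `c` is given up to the Taylor error of `u''`, leaving `c` for the
  -- second derivative of `T`.
  set c := |iteratedDeriv 2 u x₀| / 4 with hc
  have hc0 : 0 < c := by have := abs_pos.2 hu2; positivity
  obtain ⟨ρ₂, hρ₂, hball₂⟩ : ∃ ρ > 0, ∀ y ∈ Metric.ball x₀ ρ, 2 * c < |iteratedDeriv 2 u y| := by
    refine Metric.eventually_nhds_iff_ball.1 ?_
    refine continuousAt_const.eventually_lt
      (hball₁ x₀ (Metric.mem_ball_self hρ₁) 2 (by omega)).1.continuousAt.abs ?_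
    rw [hc]; have := abs_pos.2 hu2; linarith
  set ρ := min ρ₁ ρ₂ with hρ
  have hρ0 : 0 < ρ := lt_min hρ₁ hρ₂
  set I := Metric.ball x₀ ρ with hI
  have hIc : Convex ℝ I := convex_ball x₀ ρ
  have hder : ∀ i ≤ 2 * r, ∀ y ∈ I,
      HasDerivAt (iteratedDeriv i u) (iteratedDeriv (i + 1) u y) y := fun i hi y hy =>
    (hball₁ y (Metric.ball_subset_ball (min_le_left _ _) hy) i hi).1
  have hbd : ∀ i ≤ 2 * r, ∀ y ∈ I, |iteratedDeriv i u y| ≤ K := fun i hi y hy =>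
    (hball₁ y (Metric.ball_subset_ball (min_le_left _ _) hy) i hi).2
  have hcont : ContinuousOn (iteratedDeriv 0 u) I := fun y hy =>
    (hder 0 (by omega) y hy).continuousAt.continuousWithinAt
  set K' := K * (r + 1 : ℝ) ^ (2 * r) with hK'
  have hr1 : (1 : ℝ) ≤ r + 1 := by have : (0 : ℝ) ≤ r := Nat.cast_nonneg r; linarith
  have hK'0 : 0 ≤ K' := by positivity
  have hKr : K * (r + 1 : ℝ) ^ r ≤ K' :=
    mul_le_mul_of_nonneg_left (pow_le_pow_right₀ hr1 (by omega)) hK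
  obtain ⟨N₁, hN₁, h₁, hh₁, hnon⟩ := exists_abs_reconstruct_sub_le hr hk hke hA hc0 hK'0
  obtain ⟨κ, N₂, hN₂, hlin⟩ := exists_abs_linear_reconstruct_sub_le (r := r) (by omega)
  set g : ℝ := κ / (2 * r - 1).factorial with hg
  set G : ℝ → ℝ := fun x => g * iteratedDeriv (2 * r - 1) u x with hG
  set N := |g| * K + (N₁ + N₂ * K' + K) with hN
  have hgN : |g| * K ≤ N := by rw [hN]; have : 0 ≤ N₁ + N₂ * K' + K := by positivity
                               linarith
  -- The first two radii keep the whole stencil inside `I`; `c / (K + 1)` keeps the Taylor error of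
  -- `u''` on the cell below `c`; `h₁` comes from the estimate of the nonlinear weights.
  refine ⟨G, N, by positivity, min (min (ρ / 2) (ρ / (2 * (r + 1)))) (min (min 1 (c / (K + 1))) h₁),
    by positivity, ?_, ?_, ?_⟩
  · intro x hx
    have hxI : x ∈ I := Metric.ball_subset_ball (((min_le_left _ _).trans (min_le_left _ _)).trans
      (by linarith)) hx
    rw [hG, abs_mul]
    exact (mul_le_mul_of_nonneg_left (hbd _ (by omega) x hxI) (abs_nonneg _)).trans hgN
  · intro x hx y hy
    have hxI : x ∈ I := Metric.ball_subset_ball (((min_le_left _ _).trans (min_le_left _ _)).trans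
      (by linarith)) hx
    have hyI : y ∈ I := Metric.ball_subset_ball (((min_le_left _ _).trans (min_le_left _ _)).trans
      (by linarith)) hy
    have h1 := abs_taylor_remainder_le hIc (n := 1)
      (φ := fun i => iteratedDeriv (2 * r - 1 + i) u) (fun i hi y hy => hder _ (by omega) y hy)
      (hbd _ (by omega)) hyI hxI
    simp only [Finset.sum_range_one, pow_zero, Nat.factorial_zero, Nat.cast_one, div_one, mul_one,
      pow_one, add_zero] at h1
    rw [hG, ← mul_sub, abs_mul]
    calc _ ≤ |g| * (K * |x - y|) := by gcongr
      _ ≤ _ := by rw [← mul_assoc]; gcongr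
  · intro x hx h hh hhδ ε hε
    obtain ⟨ha, hb⟩ := lt_min_iff.1 hhδ
    obtain ⟨-, hh2⟩ := lt_min_iff.1 ha
    obtain ⟨hb', hhh₁⟩ := lt_min_iff.1 hb
    obtain ⟨hh1, hhc⟩ := lt_min_iff.1 hb'
    rw [lt_div_iff₀ (by positivity)] at hh2 hhc
    have hx' : x ∈ Metric.ball x₀ (ρ / 2) :=
      Metric.ball_subset_ball ((min_le_left _ _).trans (min_le_left _ _)) hx
    have hxI : x ∈ I := Metric.ball_subset_ball (by linarith) hx'
    have hstencil : ∀ ξ : ℝ, |ξ| ≤ r + 1 → x + h * ξ ∈ I := by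
      intro ξ hξ
      rw [Metric.mem_ball, Real.dist_eq] at hx' ⊢
      have h1 : |h * ξ| ≤ ρ / 2 := by
        rw [abs_mul, abs_of_pos hh]; nlinarith
      calc |x + h * ξ - x₀| = |(x - x₀) + h * ξ| := by congr 1; ring
        _ ≤ |x - x₀| + |h * ξ| := abs_add_le _ _
        _ < ρ := by linarith
    have hu0 : iteratedDeriv 0 u = u := iteratedDeriv_zero
    set φ : ℕ → ℝ → ℝ := fun i => iteratedDeriv i u with hφ
    have hTr : ∀ m : ℤ, |m| ≤ r →
        |cellAvg u x h m - unitAvg (fun ξ => (scaledTaylor φ x h r).eval ξ) m| ≤ K' * h ^ r := by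
      intro m hm
      have h1 := abs_cellAvg_sub_le (φ := φ) hIc hcont (n := r) (fun i hi => hder i (by omega)) hK
        (hbd _ (by omega)) hh hxI hstencil hm
      rw [← hu0]
      exact h1.trans (by gcongr)
    have hT2r : ∀ m : ℤ, |m| ≤ r →
        |cellAvg u x h m - unitAvg (fun ξ => (scaledTaylor φ x h (2 * r)).eval ξ) m| ≤
          K' * h ^ (2 * r) := by
      intro m hm
      have h1 := abs_cellAvg_sub_le (φ := φ) hIc hcont (n := 2 * r) (fun i hi => hder i (by omega))
        hK (hbd _ (by omega)) hh hxI hstencil hm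
      rw [← hu0]
      exact h1
    have hsecond : ∀ ξ ∈ Set.Icc (-1 / 2 : ℝ) (1 / 2),
        c * h ^ 2 ≤ |(derivative^[2] (scaledTaylor φ x h r)).eval ξ| := by
      intro ξ hξ
      have hξ1 : |ξ| ≤ 1 := abs_le.2 ⟨by linarith [hξ.1], by linarith [hξ.2]⟩
      have hmem : x + h * ξ ∈ I := hstencil ξ (by linarith)
      have h1 : (derivative^[2] (scaledTaylor φ x h r)).eval ξ =
          h ^ 2 * (scaledTaylor (fun i => φ (i + 2)) x h (r - 2)).eval ξ := by
        obtain ⟨a, rfl⟩ : ∃ a, r = a + 2 := ⟨r - 2, by omega⟩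
        change (derivative (derivative (scaledTaylor φ x h (a + 1 + 1)))).eval ξ = _
        rw [derivative_scaledTaylor, derivative_C_mul, derivative_scaledTaylor]
        simp only [eval_mul, eval_C, Nat.add_sub_cancel]
        ring
      have h2 := abs_sub_scaledTaylor_le (φ := fun i => φ (i + 2)) hIc (n := r - 2)
        (fun i hi => hder (i + 2) (by omega)) (hbd _ (by omega)) hxI hmem
      have h3 : 2 * c < |φ 2 (x + h * ξ)| :=
        hball₂ _ (Metric.ball_subset_ball (min_le_right _ _) hmem)
      have h4 : K * |h * ξ| ^ (r - 2) ≤ c := by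
        have h5 : |h * ξ| ≤ h := by
          rw [abs_mul, abs_of_pos hh]; nlinarith
        have h6 : |h * ξ| ^ (r - 2) ≤ h := by
          refine (pow_le_of_le_one (abs_nonneg _) (h5.trans hh1.le) (by omega)).trans h5
        nlinarith
      have h7 := abs_sub_abs_le_abs_sub (φ 2 (x + h * ξ))
        ((scaledTaylor (fun i => φ (i + 2)) x h (r - 2)).eval ξ)
      have h8 : c ≤ |(scaledTaylor (fun i => φ (i + 2)) x h (r - 2)).eval ξ| := by
        simp only [zero_add] at h2
        linarith
      rw [h1, abs_mul, abs_of_pos (by positivity : 0 < h ^ 2), mul_comm c]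
      gcongr
    have hdeg : ∀ n, 1 ≤ n → (scaledTaylor φ x h n).natDegree ≤ n - 1 := by
      intro n hn
      obtain ⟨a, rfl⟩ : ∃ a, n = a + 1 := ⟨n - 1, by omega⟩
      exact natDegree_scaledTaylor_le φ x h a
    -- Three errors add up: the nonlinear weights (`e1`, Taylor polynomial of degree below `r`), the
    -- linear scheme (`e2`, degree below `2 * r`), and the Taylor value at the cell boundary (`e3`).
    have e1 := hnon h hh hhh₁ (cellAvg u x h) (scaledTaylor φ x h r)
      (by have := hdeg r (by omega); omega) hTr hsecond ε hε
    have e2 := hlin (scaledTaylor φ x h (2 * r)) (hdeg (2 * r) (by omega)) (cellAvg u x h)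
      (K' * h ^ (2 * r)) hT2r
    have e3 := abs_sub_scaledTaylor_le (φ := φ) hIc (n := 2 * r) (fun i hi => hder i (by omega))
      (hbd _ le_rfl) hxI (hstencil (1 / 2) (by rw [abs_of_pos (by norm_num)]; linarith))
    have e4 : K * |h * (1 / 2)| ^ (2 * r) ≤ K * h ^ (2 * r) := by
      rw [abs_of_pos (by positivity)]
      gcongr
      linarith
    have hmid : x + h * (1 / 2) = x + h / 2 := by ring
    have hcoef : κ * (scaledTaylor φ x h (2 * r)).coeff (2 * r - 1) = G x * h ^ (2 * r - 1) := by
      rw [coeff_scaledTaylor _ _ _ (by omega), hG, hg]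
      ring
    rw [hcoef] at e2
    simp only [hφ, hu0, hmid] at e3
    have hN0 : 0 ≤ |g| * K * h ^ (2 * r) := by positivity
    rw [abs_le] at e1 e2 ⊢
    obtain ⟨e3a, e3b⟩ := abs_le.1 (e3.trans e4)
    simp only [hφ] at e1 e2
    have hsplit : N * h ^ (2 * r) = |g| * K * h ^ (2 * r) + (N₁ * h ^ (2 * r) +
      N₂ * (K' * h ^ (2 * r)) + K * h ^ (2 * r)) := by rw [hN]; ring
    rw [hsplit]
    constructor <;> linarith [e1.1, e1.2, e2.1, e2.2]

/-! ### The errors at consecutive cell boundaries and the numerical flux -/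

/-- The leading terms differ by `(G x - G (x - h)) * h ^ (2 * r - 1)`, and the Lipschitz bound on
`G` supplies the extra power of `h`. -/
theorem exists_consecutive_error_bound {r k : ℕ} (hr : 3 ≤ r) (hk : 2 ≤ k) (hke : Even k) {A : ℝ}
    (hA : 0 < A) {u : ℝ → ℝ} {x₀ : ℝ} (hu : ContDiffAt ℝ ∞ u x₀) (hu2 : iteratedDeriv 2 u x₀ ≠ 0) :
    ∃ N ≥ 0, ∃ δ > 0, ∀ x h : ℝ, |x - x₀| < δ → 0 < h → h < δ → ∀ ε > 0,
      ∀ e e' : ℝ, e = reconstruct r k A ε (cellAvg u x h) - u (x + h / 2) →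
        e' = reconstruct r k A ε (cellAvg u (x - h) h) - u (x - h / 2) →
        |e| ≤ N * h ^ (2 * r - 1) ∧ |e'| ≤ N * h ^ (2 * r - 1) ∧ |e - e'| ≤ N * h ^ (2 * r) := by
  obtain ⟨G, N, hN, δ, hδ, hG, hLip, hE⟩ := exists_reconstruct_expansion hr hk hke hA hu hu2
  refine ⟨3 * N, by positivity, min (δ / 2) 1, by positivity,
    fun x h hx hh hhδ ε hε e e' he he' => ?_⟩
  have hxδ := hx.trans_le (min_le_left _ _)
  obtain ⟨hh2, hh1⟩ := lt_min_iff.1 hhδ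
  have hxb : x ∈ Metric.ball x₀ δ := by rw [Metric.mem_ball, Real.dist_eq]; linarith
  have hyb : x - h ∈ Metric.ball x₀ δ := by
    rw [Metric.mem_ball, Real.dist_eq]
    rw [abs_lt] at hxδ ⊢
    constructor <;> linarith
  have ex := hE x hxb h hh (by linarith) ε hε
  have ey := hE (x - h) hyb h hh (by linarith) ε hε
  rw [← he] at ex
  rw [show x - h + h / 2 = x - h / 2 by ring, ← he'] at ey
  have hpow : h ^ (2 * r) = h ^ (2 * r - 1) * h := by rw [← pow_succ]; congr 1; omega
  set t := h ^ (2 * r - 1) with ht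
  have ht0 : 0 ≤ t := by positivity
  have hNt : 0 ≤ N * t := by positivity
  have hle : N * h ^ (2 * r) ≤ N * t := by
    rw [hpow, ← mul_assoc]; exact mul_le_of_le_one_right hNt hh1.le
  have hsmall : ∀ z ∈ Metric.ball x₀ δ, ∀ d : ℝ, |d - G z * t| ≤ N * h ^ (2 * r) →
      |d| ≤ 3 * N * t := by
    intro z hz d hd
    have h1 : |G z * t| ≤ N * t := by
      rw [abs_mul, abs_of_nonneg ht0]; exact mul_le_mul_of_nonneg_right (hG z hz) ht0
    have h2 := abs_add_le (d - G z * t) (G z * t)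
    rw [sub_add_cancel] at h2
    linarith
  refine ⟨hsmall x hxb e ex, hsmall _ hyb e' ey, ?_⟩
  have hdiff : |(G x - G (x - h)) * t| ≤ N * h ^ (2 * r) := by
    have h1 := hLip x hxb _ hyb
    rw [sub_sub_cancel, abs_of_pos hh] at h1
    rw [abs_mul, abs_of_nonneg ht0, hpow]
    nlinarith
  rw [abs_le] at ex ey hdiff ⊢
  constructor <;> nlinarith [ex.1, ex.2, ey.1, ey.2, hdiff.1, hdiff.2]

/-- Pass through `f (a + e')`: the change from `e` to `e'` costs `|e - e'|`, and `y ↦ f (y + e') - f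
y` has derivative `O(|e'|)`, which costs `|e'| * |a - b|`. -/
theorem exists_flux_increment_bound {f : ℝ → ℝ} (hf : ContDiff ℝ ∞ f) (M : ℝ) :
    ∃ L ≥ 0, ∀ a b e e' : ℝ, |a| ≤ M → |b| ≤ M → |e| ≤ 1 → |e'| ≤ 1 →
      |f (a + e) - f a - (f (b + e') - f b)| ≤ L * (|e - e'| + |e'| * |a - b|) := by
  have hf1 : ContDiff ℝ ∞ (deriv f) := (contDiff_infty_iff_deriv.1 hf).2
  have hd : ∀ y, HasDerivAt f (deriv f y) y := fun y =>
    (hf.differentiable (by simp) y).hasDerivAt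
  have hd1 : ∀ y, HasDerivAt (deriv f) (deriv (deriv f) y) y := fun y =>
    (hf1.differentiable (by simp) y).hasDerivAt
  set I := Set.Icc (-(M + 1)) (M + 1) with hI
  have hIc : Convex ℝ I := convex_Icc _ _
  obtain ⟨L₁, hL₁⟩ := isCompact_Icc.exists_bound_of_continuousOn
    (s := I) hf1.continuous.continuousOn
  obtain ⟨L₂, hL₂⟩ := isCompact_Icc.exists_bound_of_continuousOn
    (s := I) (contDiff_infty_iff_deriv.1 hf1).2.continuous.continuousOn
  set L := max (max L₁ L₂) 0 with hL
  have hL1 : ∀ y ∈ I, ‖deriv f y‖ ≤ L := fun y hy =>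
    (hL₁ y hy).trans ((le_max_left _ _).trans (le_max_left _ _))
  have hL2 : ∀ y ∈ I, ‖deriv (deriv f) y‖ ≤ L := fun y hy =>
    (hL₂ y hy).trans ((le_max_right _ _).trans (le_max_left _ _))
  refine ⟨L, le_max_right _ _, fun a b e e' ha hb he he' => ?_⟩
  have hmem : ∀ c d : ℝ, |c| ≤ M → |d| ≤ 1 → c + d ∈ I := by
    intro c d hc hd
    rw [abs_le] at hc hd
    constructor <;> linarith [hc.1, hc.2, hd.1, hd.2]
  have h1 : |f (a + e) - f (a + e')| ≤ L * |e - e'| := by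
    have := hIc.norm_image_sub_le_of_norm_hasDerivWithin_le
      (fun y _ => (hd y).hasDerivWithinAt) hL1 (hmem a e' ha he') (hmem a e ha he)
    simpa using this
  have h2 : |f (a + e') - f a - (f (b + e') - f b)| ≤ L * |e'| * |a - b| := by
    have h3 : ∀ y ∈ Set.Icc (-M) M, ‖deriv f (y + e') - deriv f y‖ ≤ L * |e'| := by
      intro y hy
      have hy' := abs_le.2 hy
      have := hIc.norm_image_sub_le_of_norm_hasDerivWithin_le
        (fun y _ => (hd1 y).hasDerivWithinAt) hL2 (by simpa using hmem y 0 hy' (by simp))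
        (hmem y e' hy' he')
      simpa using this
    exact (convex_Icc (-M) M).norm_image_sub_le_of_norm_hasDerivWithin_le
      (f := fun y => f (y + e') - f y)
      (fun y _ => (((hd (y + e')).comp_add_const y e').sub (hd y)).hasDerivWithinAt) h3
      (abs_le.1 hb) (abs_le.1 ha)
  calc _ = |(f (a + e) - f (a + e')) + (f (a + e') - f a - (f (b + e') - f b))| := by
        congr 1; ring
    _ ≤ _ := (abs_add_le _ _).trans (by linarith)

/-! ### Translation and reflection of the cell averages -/

theorem cellAvg_shift (u : ℝ → ℝ) (x h : ℝ) (j m : ℤ) :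
    cellAvg u x h (j + m) = cellAvg u (x + j * h) h m := by
  unfold cellAvg
  push_cast
  congr 2 <;> ring

theorem cellAvg_comp_neg (u : ℝ → ℝ) (x h : ℝ) (m : ℤ) :
    cellAvg (fun y => u (-y)) x h m = cellAvg u (-x) h (-m) := by
  unfold cellAvg
  rw [intervalIntegral.integral_comp_neg]
  push_cast
  congr 2 <;> ring

theorem uMinus_cellAvg (r k : ℕ) (A ε : ℝ) (u : ℝ → ℝ) (x h : ℝ) (j : ℤ) :
    uMinus r k A ε (cellAvg u x h) j = reconstruct r k A ε (cellAvg u (x + j * h) h) := by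
  unfold uMinus
  congr 1
  funext m
  exact cellAvg_shift u x h j m

/-- Reflection `y ↦ -y` makes the right-biased value a left-biased one for `u (-y)`, whose current
cell is the mirror image of cell `j + 1`. -/
theorem uPlus_cellAvg (r k : ℕ) (A ε : ℝ) (u : ℝ → ℝ) (x h : ℝ) (j : ℤ) :
    uPlus r k A ε (cellAvg u x h) j =
      reconstruct r k A ε (cellAvg (fun y => u (-y)) (-(x + (j + 1) * h)) h) := by
  unfold uPlus
  congr 1
  funext m
  rw [cellAvg_comp_neg, neg_neg, sub_eq_add_neg, cellAvg_shift]
  push_cast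
  rfl

end MOPWENO

theorem mainTheorem5 (r k : ℕ) (A : ℝ) (hr : 3 ≤ r) (hk : 2 ≤ k) (hk_even : Even k) (hA : 0 < A)
    (u : ℝ → ℝ) (x₀ : ℝ) (hu : ContDiffAt ℝ ∞ u x₀)
    (hcp : MOPWENO.IsCriticalPointOfOrder u 1 x₀)
    (f : ℝ → ℝ) (hf : ContDiff ℝ ∞ f) (α : ℝ) :
    ∃ C : ℝ, ∃ δ > 0, ∀ x Δx : ℝ, |x - x₀| < δ → 0 < Δx → Δx < δ → ∀ ε > 0,
      |MOPWENO.uMinus r k A ε (MOPWENO.cellAvg u x Δx) 0 - u (x + Δx / 2)|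
          ≤ C * Δx ^ (2 * r - 1) ∧
      |MOPWENO.uPlus r k A ε (MOPWENO.cellAvg u x Δx) 0 - u (x + Δx / 2)|
          ≤ C * Δx ^ (2 * r - 1) ∧
      |MOPWENO.semiDiscrete r k A ε f α Δx (MOPWENO.cellAvg u x Δx) 0
          - -(1 / Δx) * (f (u (x + Δx / 2)) - f (u (x - Δx / 2)))|
          ≤ C * Δx ^ (2 * r - 1) := by
  have hu2 : iteratedDeriv 2 u x₀ ≠ 0 := hcp.2
  have hv : ContDiffAt ℝ ∞ (fun y => u (-y)) (-x₀) := by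
    refine ContDiffAt.comp (-x₀) (g := u) ?_ contDiff_neg.contDiffAt
    rwa [neg_neg]
  have hv2 : iteratedDeriv 2 (fun y => u (-y)) (-x₀) ≠ 0 := by
    rw [iteratedDeriv_comp_neg, neg_neg]
    simpa using hu2
  obtain ⟨N₁, hN₁, δ₁, hδ₁, hminus⟩ :=
    MOPWENO.exists_consecutive_error_bound hr hk hk_even hA hu hu2
  obtain ⟨N₂, hN₂, δ₂, hδ₂, hplus⟩ :=
    MOPWENO.exists_consecutive_error_bound hr hk hk_even hA hv hv2
  obtain ⟨ρ, hρ, K, hK, hball⟩ := MOPWENO.exists_iteratedDeriv_bound hu 1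
  obtain ⟨L, hL, hflux⟩ := MOPWENO.exists_flux_increment_bound hf K
  set N := max N₁ N₂ with hN
  have hN0 : 0 ≤ N := hN₁.trans (le_max_left _ _)
  -- In `C`, `N` serves the boundary values, `L * (N + N * K)` the increments of `f`, and `|α| * N`
  -- the dissipation. The radius `1 / (N + 1)` keeps the errors below `1`, as the flux estimate
  -- requires.
  refine ⟨N + (L * (N + N * K) + |α| * N),
    min (min δ₁ (δ₂ / 2)) (min (ρ / 2) (min 1 (1 / (N + 1)))), by positivity,
    fun x h hx hh hhδ ε hε => ?_⟩
  obtain ⟨hx', hx''⟩ := lt_min_iff.1 hx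
  obtain ⟨hx1, hx2⟩ := lt_min_iff.1 hx'
  obtain ⟨hx3, -⟩ := lt_min_iff.1 hx''
  obtain ⟨hh', hh''⟩ := lt_min_iff.1 hhδ
  obtain ⟨hh1, hh2⟩ := lt_min_iff.1 hh'
  obtain ⟨hh3, hh4⟩ := lt_min_iff.1 hh''
  obtain ⟨hh5, hh6⟩ := lt_min_iff.1 hh4
  rw [lt_div_iff₀ (by positivity)] at hh6
  have hpow : h ^ (2 * r) = h ^ (2 * r - 1) * h := by rw [← pow_succ]; congr 1; omega
  set t := h ^ (2 * r - 1) with ht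
  have ht0 : 0 ≤ t := by positivity
  have hth : t ≤ h := pow_le_of_le_one hh.le hh5.le (by omega)
  have hNt : N * t ≤ 1 := by nlinarith
  have hNt₁ : N₁ * t ≤ N * t := by gcongr; exact le_max_left _ _
  have hNt₂ : N₂ * t ≤ N * t := by gcongr; exact le_max_right _ _
  have hNth₁ : N₁ * h ^ (2 * r) ≤ N * t * h := by
    rw [hpow, ← mul_assoc]; exact mul_le_mul_of_nonneg_right hNt₁ hh.le
  have hNth₂ : N₂ * h ^ (2 * r) ≤ N * t * h := by
    rw [hpow, ← mul_assoc]; exact mul_le_mul_of_nonneg_right hNt₂ hh.le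
  set v := MOPWENO.cellAvg u x h with hvdef
  set a := u (x + h / 2) with ha
  set b := u (x - h / 2) with hb
  obtain ⟨em, hem⟩ : ∃ e, e = MOPWENO.uMinus r k A ε v 0 - a := ⟨_, rfl⟩
  obtain ⟨em', hem'⟩ : ∃ e, e = MOPWENO.uMinus r k A ε v (0 - 1) - b := ⟨_, rfl⟩
  obtain ⟨ep, hep⟩ : ∃ e, e = MOPWENO.uPlus r k A ε v 0 - a := ⟨_, rfl⟩
  obtain ⟨ep', hep'⟩ : ∃ e, e = MOPWENO.uPlus r k A ε v (0 - 1) - b := ⟨_, rfl⟩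
  obtain ⟨m1, m2, m3⟩ := hminus x h hx1 hh hh1 ε hε em em'
    (by rw [hem, hvdef, MOPWENO.uMinus_cellAvg]; simp [ha])
    (by rw [hem', hvdef, MOPWENO.uMinus_cellAvg]; simp [hb, sub_eq_add_neg])
  -- Reflection exchanges the two boundaries of the cell: the left one, with error `ep'`, now comes
  -- first.
  obtain ⟨p1, p2, p3⟩ := hplus (-x) h
    (by rw [neg_sub_neg, abs_sub_comm]; linarith) hh (by linarith) ε hε ep' ep
    (by
      rw [hep', hvdef, MOPWENO.uPlus_cellAvg, hb]
      simp only [neg_add, neg_neg]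
      congr 3
      push_cast; ring)
    (by
      rw [hep, hvdef, MOPWENO.uPlus_cellAvg, ha]
      congr 3
      · push_cast; ring
      · ring)
  rw [abs_sub_comm] at p3
  have hmemball : ∀ z : ℝ, |z| ≤ h → x + z ∈ Metric.ball x₀ ρ := by
    intro z hz
    rw [Metric.mem_ball, Real.dist_eq]
    calc |x + z - x₀| = |(x - x₀) + z| := by congr 1; ring
      _ ≤ |x - x₀| + |z| := abs_add_le _ _
      _ < ρ := by linarith
  have hxa : x + h / 2 ∈ Metric.ball x₀ ρ :=
    hmemball _ (by rw [abs_of_pos (by positivity)]; linarith)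
  have hxb : x - h / 2 ∈ Metric.ball x₀ ρ := by
    rw [sub_eq_add_neg]
    exact hmemball _ (by rw [abs_neg, abs_of_pos (by positivity)]; linarith)
  have habs : ∀ z ∈ Metric.ball x₀ ρ, |u z| ≤ K := fun z hz => by
    simpa using (hball z hz 0 (by omega)).2
  have hab : |a - b| ≤ K * h := by
    have h1 := MOPWENO.abs_taylor_remainder_le (convex_ball x₀ ρ) (n := 1)
      (φ := fun i => iteratedDeriv i u) (fun i hi y hy => (hball y hy i (by omega)).1)
      (fun y hy => (hball y hy 1 le_rfl).2) hxb hxa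
    simp only [Finset.sum_range_one, pow_zero, Nat.factorial_zero, Nat.cast_one, div_one, mul_one,
      pow_one, iteratedDeriv_zero] at h1
    rwa [show x + h / 2 - (x - h / 2) = h by ring, abs_of_pos hh] at h1
  have hinc : ∀ e e' : ℝ, |e| ≤ N * t → |e'| ≤ N * t → |e - e'| ≤ N * t * h →
      |f (a + e) - f a - (f (b + e') - f b)| ≤ L * (N + N * K) * t * h := by
    intro e e' he he' hee
    refine (hflux a b e e' (habs _ hxa) (habs _ hxb) (he.trans hNt) (he'.trans hNt)).trans ?_
    have h1 : |e'| * |a - b| ≤ N * t * (K * h) := by gcongr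
    calc _ ≤ L * (N * t * h + N * t * (K * h)) := by gcongr
      _ = _ := by ring
  have hDm := hinc em em' (m1.trans hNt₁) (m2.trans hNt₁) (m3.trans hNth₁)
  have hDp := hinc ep ep' (p2.trans hNt₂) (p1.trans hNt₂) (p3.trans hNth₂)
  have hrest : 0 ≤ (L * (N + N * K) + |α| * N) * t := by positivity
  refine ⟨?_, ?_, ?_⟩
  · rw [← hem, add_mul]; linarith
  · rw [← hep, add_mul]; linarith
  · have e1 : MOPWENO.uMinus r k A ε v 0 = a + em := by rw [hem]; ring
    have e2 : MOPWENO.uMinus r k A ε v (0 - 1) = b + em' := by rw [hem']; ring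
    have e3 : MOPWENO.uPlus r k A ε v 0 = a + ep := by rw [hep]; ring
    have e4 : MOPWENO.uPlus r k A ε v (0 - 1) = b + ep' := by rw [hep']; ring
    set Dm := f (a + em) - f a - (f (b + em') - f b) with hDmdef
    set Dp := f (a + ep) - f a - (f (b + ep') - f b) with hDpdef
    -- The exact values cancel from the jumps `u⁺ - u⁻`, so the dissipation involves only
    -- differences of consecutive errors. Every term is then `O(h ^ (2 * r))` before the division by
    -- `h`.
    have hmain : MOPWENO.semiDiscrete r k A ε f α h v 0 - -(1 / h) * (f a - f b) =
        -((Dm + Dp - α * ((ep - ep') - (em - em'))) / 2 / h) := by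
      unfold MOPWENO.semiDiscrete MOPWENO.numFlux MOPWENO.laxFriedrichs
      rw [e1, e2, e3, e4, hDmdef, hDpdef]
      ring
    have hα : |α * ((ep - ep') - (em - em'))| ≤ |α| * (2 * (N * t * h)) := by
      rw [abs_mul]
      refine mul_le_mul_of_nonneg_left ?_ (abs_nonneg _)
      refine (abs_sub _ _).trans ?_
      linarith
    rw [hmain, abs_neg, abs_div, abs_div, abs_two, abs_of_pos hh, div_le_iff₀ hh]
    have htot : |Dm + Dp - α * ((ep - ep') - (em - em'))| ≤
        L * (N + N * K) * t * h + L * (N + N * K) * t * h + |α| * (2 * (N * t * h)) :=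
      (abs_sub _ _).trans (add_le_add ((abs_add_le _ _).trans (add_le_add hDm hDp)) hα)
    have hNth : 0 ≤ N * t * h := by positivity
    have hC : (N + (L * (N + N * K) + |α| * N)) * t * h =
        N * t * h + L * (N + N * K) * t * h + |α| * (2 * (N * t * h)) / 2 := by ring
    rw [hC]
    linarith
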